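/- Fix an integer $k\ge 2$ and a real $\varepsilon>0$. Let $H(n,k,p)$ be the binomial random $k$-uniform hypergraph on $n$ labelled vertices: each $k$-element set of vertices is an edge independently with probability $p$, i.e. a given $k$-uniform hypergraph with $m$ edges on the vertex set has probability $p^{m}(1-p)^{\binom nk-m}$. A set of vertices is independent if it does not contain any edge entirely; $\alpha(H)$ is the maximum size of an independent set of $H$, and $X_s$ is the number of independent sets of size $s$ in $H(n,k,p)$. Let $p=p(n)$ be a sequence such that $$n^{-\frac{(k-1)^2}{k}+\varepsilon}<p(n)\ \text{ for all sufficiently large } n,\qquad p(n)\to 0\quad(n\to\infty).$$ Then for all sufficiently large $n$ there is a largest integer $s_x=s_x(n)$ with $\mathbb E[X_{s_x}]>\varepsilon\log n$ (natural logarithm, expectation in $H(n,k,p(n))$), and $$\mathbb P\bigl(\alpha(H(n,k,p(n)))\in\{s_x,\,s_x+1\}\bigr)\longrightarrow 1\qquad(n\to\infty).$$ -/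

import Mathlib

open MeasureTheory Filter Topology

/-- A `k`-uniform hypergraph on the finite vertex set `V`: a set of `k`-element subsets of `V`. -/
@[ext]
structure UniformHypergraph (V : Type*) (k : ℕ) where
  edges : Finset (Finset V)
  uniform : ∀ e ∈ edges, e.card = k

namespace UniformHypergraph

variable {V : Type*} {k : ℕ}

theorem edges_injective :
    Function.Injective (edges : UniformHypergraph V k → Finset (Finset V)) :=
  fun _ _ h => UniformHypergraph.ext h

noncomputable instance [Fintype V] : Fintype (UniformHypergraph V k) :=
  Fintype.ofInjective edges edges_injective

instance : MeasurableSpace (UniformHypergraph V k) := ⊤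

instance : DiscreteMeasurableSpace (UniformHypergraph V k) := ⟨fun _ => trivial⟩

/-- `S` is a (weakly) independent set of `H`: it contains no edge of `H` entirely. -/
def IsIndep (H : UniformHypergraph V k) (S : Finset V) : Prop :=
  ∀ e ∈ H.edges, ¬ e ⊆ S

open Classical in
/-- The independence number `α(H)`: the maximum size of an independent set. -/
noncomputable def indepNum [Fintype V] (H : UniformHypergraph V k) : ℕ :=
  (Finset.univ.filter fun S : Finset V => H.IsIndep S).sup Finset.card

open Classical in
/-- `X_s(H)`: the number of independent sets of size `s` in `H`. -/
noncomputable def numIndep [Fintype V] (s : ℕ) (H : UniformHypergraph V k) : ℕ :=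
  (Finset.univ.filter fun S : Finset V => H.IsIndep S ∧ S.card = s).card

end UniformHypergraph

/-- The law of the binomial random hypergraph `H(n, k, p)` on the vertex set `Fin n`: a given
`k`-uniform hypergraph with `m` edges has probability `p ^ m * (1 - p) ^ (n.choose k - m)`.
It is a probability measure for `0 ≤ p ≤ 1`. -/
noncomputable def randomHypergraph (n k : ℕ) (p : ℝ) : Measure (UniformHypergraph (Fin n) k) :=
  ∑ H : UniformHypergraph (Fin n) k,
    ENNReal.ofReal (p ^ H.edges.card * (1 - p) ^ (n.choose k - H.edges.card)) • Measure.dirac H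

theorem randomHypergraph_isProbabilityMeasure (n k : ℕ) {p : ℝ} (h0 : 0 ≤ p) (h1 : p ≤ 1) :
    IsProbabilityMeasure (randomHypergraph n k p) := by
  constructor
  have key : ∑ H : UniformHypergraph (Fin n) k,
      p ^ H.edges.card * (1 - p) ^ (n.choose k - H.edges.card) = 1 := by
    have hc : ((Finset.univ : Finset (Fin n)).powersetCard k).card = n.choose k := by simp
    have h := Finset.sum_pow_mul_eq_add_pow p (1 - p)
      ((Finset.univ : Finset (Fin n)).powersetCard k)
    rw [hc, add_sub_cancel, one_pow] at h
    refine Eq.trans ?_ h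
    refine Finset.sum_bij (fun H _ => H.edges) ?_ ?_ ?_ ?_
    · intro H _
      simp only [Finset.mem_powerset]
      intro e he
      simpa [Finset.mem_powersetCard] using H.uniform e he
    · intro a _ b _ hab
      exact UniformHypergraph.edges_injective hab
    · intro E hE
      refine ⟨⟨E, fun e he => ?_⟩, Finset.mem_univ _, rfl⟩
      exact (Finset.mem_powersetCard.1 (Finset.mem_powerset.1 hE he)).2
    · intro _ _
      rfl
  rw [randomHypergraph]
  simp only [Measure.coe_finsetSum, Finset.sum_apply, Measure.smul_apply, measure_univ,
    smul_eq_mul, mul_one]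
  rw [← ENNReal.ofReal_sum_of_nonneg, key, ENNReal.ofReal_one]
  intro H _
  exact mul_nonneg (pow_nonneg h0 _) (pow_nonneg (by linarith) _)

/-- `E[X_s]`: the expected number of independent sets of size `s` in `H(n, k, p)`. -/
noncomputable def expectedNumIndep (n k : ℕ) (p : ℝ) (s : ℕ) : ℝ :=
  ∫ H, (H.numIndep s : ℝ) ∂(randomHypergraph n k p)

/-- The sizes `s` with `E[X_s] > ε log n`. -/
def thresholdSizes (n k : ℕ) (p ε : ℝ) : Set ℕ :=
  {s | ε * Real.log n < expectedNumIndep n k p s}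

/-- The expectation threshold `s_x`: the largest `s` with `E[X_s] > ε log n`. -/
noncomputable def expectationThreshold (n k : ℕ) (p ε : ℝ) : ℕ :=
  sSup (thresholdSizes n k p ε)

/-! Write `s` for the threshold and ignore powers of `log n`. Since E[X_{s+1}] ≤ ε log n, a given
outside vertex extends an independent `s`-set with probability (1-p)^C(s,k-1) at most about (s/n)^k
(`le_neg_log_mul_choose_pred`). Hence E[X_{s+2}] is at most about (n/s)(s/n)^k, which tends to 0,
and the union bound gives α ≤ s + 1.

For α ≥ s a plain second moment of X_s is not enough: pairs of sets differing in few vertices can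
dominate it. The sets counted instead are the robust ones (`robustIndep`): independent, with every
outside vertex sending at least two edges into the set. The lower bound on `p` amounts to s ≤
n^(1-1/k-c) for some c > 0 (`log_threshold_le`), so n(s/n)^k → 0 and robustness costs only a factor
1 - o(1) in the first moment (`le_real_robustIndep`). In return, if `S` is robust and `T`
independent, each vertex of `T \ S` needs two edges into `S` that are not contained in `T`. This
makes nearby pairs rare (`real_robustIndep_inter_le`, `near_term_le`).

Pairs are split by l = |S ∩ T| at η s. For l < η s independence alone gives a total of (1 + o(1))
E[X_s]² (`far_sum_le`). The other pairs contribute at most 2 E[X_s] (`near_sum_le`), negligible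
because E[X_s] > ε log n. Cauchy–Schwarz (`sq_sum_real_le`) then gives P(α ≥ s) → 1. -/

/-! ### Finite sums, cylinder events and the second moment inequality -/

/-- The probability of a single hypergraph under `randomHypergraph n k p`. -/
noncomputable def hypergraphWeight (n k : ℕ) (p : ℝ) (H : UniformHypergraph (Fin n) k) : ℝ :=
  p ^ H.edges.card * (1 - p) ^ (n.choose k - H.edges.card)

theorem hypergraphWeight_nonneg {n k : ℕ} {p : ℝ} (h0 : 0 ≤ p) (h1 : p ≤ 1)
    (H : UniformHypergraph (Fin n) k) : 0 ≤ hypergraphWeight n k p H :=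
  mul_nonneg (pow_nonneg h0 _) (pow_nonneg (by linarith) _)

theorem integral_randomHypergraph {n k : ℕ} {p : ℝ} (h0 : 0 ≤ p) (h1 : p ≤ 1)
    (f : UniformHypergraph (Fin n) k → ℝ) :
    ∫ H, f H ∂(randomHypergraph n k p) = ∑ H, hypergraphWeight n k p H * f H := by
  rw [randomHypergraph, integral_finsetSum_measure]
  · refine Finset.sum_congr rfl fun H _ => ?_
    rw [integral_smul_measure, integral_dirac]
    exact congrArg (· * f H) (ENNReal.toReal_ofReal (hypergraphWeight_nonneg h0 h1 H))
  · intro H _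
    exact (integrable_dirac (by simp [enorm_lt_top])).smul_measure ENNReal.ofReal_ne_top

theorem randomHypergraph_real_eq_sum {n k : ℕ} {p : ℝ} (h0 : 0 ≤ p) (h1 : p ≤ 1)
    (A : Set (UniformHypergraph (Fin n) k)) :
    (randomHypergraph n k p).real A =
      ∑ H, hypergraphWeight n k p H * A.indicator 1 H := by
  have := randomHypergraph_isProbabilityMeasure n k h0 h1
  rw [← integral_randomHypergraph h0 h1, ← integral_indicator_one (MeasurableSet.of_discrete)]

/-- The event that all sets in `A` and no set in `B` are edges. -/
def edgeCylinder {n k : ℕ} (A B : Finset (Finset (Fin n))) : Set (UniformHypergraph (Fin n) k) :=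
  {H | A ⊆ H.edges ∧ Disjoint B H.edges}

theorem randomHypergraph_real_edgeCylinder {n k : ℕ} {p : ℝ} (h0 : 0 ≤ p) (h1 : p ≤ 1)
    {A B : Finset (Finset (Fin n))} (hA : A ⊆ Finset.univ.powersetCard k)
    (hB : B ⊆ Finset.univ.powersetCard k) (hAB : Disjoint A B) :
    (randomHypergraph n k p).real (edgeCylinder A B) = p ^ A.card * (1 - p) ^ B.card := by
  classical
  set U : Finset (Finset (Fin n)) := Finset.univ.powersetCard k with hU
  have hc : U.card = n.choose k := by simp [hU]
  rw [randomHypergraph_real_eq_sum h0 h1]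
  -- Expanding this product over all `k`-sets gives one term per edge set; the zeros kill exactly
  -- those that use an edge from `B` or omit one from `A`.
  have hprod := Finset.prod_add (fun e => if e ∈ B then 0 else p)
    (fun e => if e ∈ A then 0 else 1 - p) U
  have hlhs : ∏ e ∈ U, ((if e ∈ B then 0 else p) + (if e ∈ A then 0 else 1 - p)) =
      p ^ A.card * (1 - p) ^ B.card := by
    have : ∀ e ∈ U, ((if e ∈ B then 0 else p) + (if e ∈ A then 0 else 1 - p)) =
        (if e ∈ A then p else 1) * (if e ∈ B then 1 - p else 1) := by
      intro e _
      by_cases ha : e ∈ A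
      · have hb : e ∉ B := Finset.disjoint_left.1 hAB ha
        simp [ha, hb]
      · by_cases hb : e ∈ B <;> simp [ha, hb]
    rw [Finset.prod_congr rfl this, Finset.prod_mul_distrib, Finset.prod_ite_mem,
      Finset.prod_ite_mem, Finset.inter_eq_right.2 hA, Finset.inter_eq_right.2 hB]
    simp
  rw [← hlhs, hprod]
  refine Finset.sum_bij (fun H _ => H.edges) ?_ ?_ ?_ ?_
  · intro H _
    rw [Finset.mem_powerset]
    intro e he
    simpa [hU, Finset.mem_powersetCard] using H.uniform e he
  · intro a _ b _ hab
    exact UniformHypergraph.edges_injective hab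
  · intro E hE
    refine ⟨⟨E, fun e he => ?_⟩, Finset.mem_univ _, rfl⟩
    exact (Finset.mem_powersetCard.1 (Finset.mem_powerset.1 hE he)).2
  · intro H _
    have hsub : H.edges ⊆ U := by
      intro e he
      simpa [hU, Finset.mem_powersetCard] using H.uniform e he
    by_cases hH : H ∈ edgeCylinder A B
    · rw [Set.indicator_of_mem hH, Pi.one_apply, mul_one]
      obtain ⟨h1, h2⟩ := hH
      have p1 : ∏ e ∈ H.edges, (if e ∈ B then 0 else p) = p ^ H.edges.card :=
        Finset.prod_eq_pow_card fun e he => if_neg (Finset.disjoint_right.1 h2 he)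
      have p2 : ∏ e ∈ U \ H.edges, (if e ∈ A then 0 else 1 - p) =
          (1 - p) ^ (U \ H.edges).card :=
        Finset.prod_eq_pow_card fun e he => if_neg fun h => (Finset.mem_sdiff.1 he).2 (h1 h)
      rw [p1, p2, Finset.card_sdiff_of_subset hsub, hc, hypergraphWeight]
    · rw [Set.indicator_of_notMem hH, mul_zero]
      symm
      by_cases hA' : A ⊆ H.edges
      · have : ¬ Disjoint B H.edges := fun h => hH ⟨hA', h⟩
        obtain ⟨e, heB, heH⟩ := Finset.not_disjoint_iff.1 this
        rw [Finset.prod_eq_zero heH (by simp [heB]), zero_mul]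
      · obtain ⟨e, heA, heH⟩ := Finset.not_subset.1 hA'
        rw [Finset.prod_eq_zero (s := U \ H.edges) (i := e)
          (Finset.mem_sdiff.2 ⟨hA heA, heH⟩) (by simp [heA]), mul_zero]

/-- The second moment inequality for a finite family of events. -/
theorem sq_sum_real_le {n k : ℕ} {p : ℝ} (h0 : 0 ≤ p) (h1 : p ≤ 1) {ι : Type*} (I : Finset ι)
    (G : ι → Set (UniformHypergraph (Fin n) k)) :
    (∑ i ∈ I, (randomHypergraph n k p).real (G i)) ^ 2 ≤
      (∑ i ∈ I, ∑ j ∈ I, (randomHypergraph n k p).real (G i ∩ G j)) *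
        (randomHypergraph n k p).real (⋃ i ∈ I, G i) := by
  classical
  simp only [randomHypergraph_real_eq_sum h0 h1]
  set w := hypergraphWeight n k p
  have hw : ∀ H, 0 ≤ w H := hypergraphWeight_nonneg h0 h1
  set Y : UniformHypergraph (Fin n) k → ℝ := fun H => ∑ i ∈ I, (G i).indicator 1 H with hY
  have e1 : ∑ i ∈ I, ∑ H, w H * (G i).indicator 1 H = ∑ H, w H * Y H := by
    rw [Finset.sum_comm]
    simp only [hY, Finset.mul_sum]
  have e2 : ∑ i ∈ I, ∑ j ∈ I, ∑ H, w H * (G i ∩ G j).indicator 1 H =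
      ∑ H, w H * Y H ^ 2 := by
    have : ∀ H, w H * Y H ^ 2 =
        ∑ i ∈ I, ∑ j ∈ I, w H * (G i ∩ G j).indicator 1 H := by
      intro H
      rw [pow_two, hY, Finset.sum_mul_sum, Finset.mul_sum]
      refine Finset.sum_congr rfl fun i _ => ?_
      rw [Finset.mul_sum]
      refine Finset.sum_congr rfl fun j _ => ?_
      by_cases hi : H ∈ G i <;> by_cases hj : H ∈ G j <;> simp [hi, hj]
    simp only [this]
    rw [Finset.sum_comm (s := Finset.univ)]
    refine Finset.sum_congr rfl fun i _ => ?_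
    rw [Finset.sum_comm]
  rw [e1, e2]
  -- Cauchy–Schwarz for `Y` and the indicator of the union, outside which `Y` vanishes.
  refine Finset.sum_sq_le_sum_mul_sum_of_sq_le_mul _ (fun H _ => mul_nonneg (hw H) (sq_nonneg _))
    (fun H _ => mul_nonneg (hw H) (Set.indicator_nonneg (by simp) _)) fun H _ => le_of_eq ?_
  by_cases hH : H ∈ ⋃ i ∈ I, G i
  · rw [Set.indicator_of_mem hH, Pi.one_apply]; ring
  · have : Y H = 0 := by
      refine Finset.sum_eq_zero fun i hi => Set.indicator_of_notMem (fun h => hH ?_) _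
      exact Set.mem_biUnion hi h
    rw [this]; simp

/-! ### Independent sets, stars and robust independence -/

namespace UniformHypergraph

theorem isIndep_iff_disjoint {V : Type*} {k : ℕ} (H : UniformHypergraph V k) (S : Finset V) :
    H.IsIndep S ↔ Disjoint (S.powersetCard k) H.edges := by
  rw [Finset.disjoint_left]
  constructor
  · intro h e he heH
    exact h e heH (Finset.mem_powersetCard.1 he).1
  · intro h e heH he
    exact h (Finset.mem_powersetCard.2 ⟨he, H.uniform e heH⟩) heH

theorem IsIndep.mono {V : Type*} {k : ℕ} {H : UniformHypergraph V k} {S T : Finset V}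
    (h : H.IsIndep T) (hST : S ⊆ T) : H.IsIndep S :=
  fun e he heS => h e he (heS.trans hST)

/-- Subsets of independent sets are independent, so every smaller positive size occurs. Size 0 is
excluded: for `k = 0` the edge `∅` leaves no independent set at all, while the empty supremum is
still 0. -/
theorem le_indepNum_iff {V : Type*} [Fintype V] {k : ℕ} (H : UniformHypergraph V k) {s : ℕ}
    (hs : s ≠ 0) : s ≤ H.indepNum ↔ (∃ S : Finset V, H.IsIndep S ∧ S.card = s) := by
  classical
  constructor
  · intro h
    obtain ⟨S, hS, hsS⟩ := (Finset.le_sup_iff (Nat.pos_of_ne_zero hs)).1 h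
    obtain ⟨T, hTS, hT⟩ := Finset.exists_subset_card_eq hsS
    exact ⟨T, (Finset.mem_filter.1 hS).2.mono hTS, hT⟩
  · rintro ⟨S, hS, rfl⟩
    exact Finset.le_sup (f := Finset.card) (Finset.mem_filter.2 ⟨Finset.mem_univ _, hS⟩)

/-- The `k`-sets contained in `S ∪ {v}` but not in `S`. -/
def starEdges {V : Type*} [DecidableEq V] (k : ℕ) (S : Finset V) (v : V) : Finset (Finset V) :=
  (insert v S).powersetCard k \ S.powersetCard k

section starEdges

variable {V : Type*} [DecidableEq V] {k : ℕ} {S : Finset V} {v : V} {e : Finset V}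

theorem mem_starEdges : e ∈ starEdges k S v ↔ e ⊆ insert v S ∧ e.card = k ∧ ¬ e ⊆ S := by
  simp only [starEdges, Finset.mem_sdiff, Finset.mem_powersetCard]
  tauto

theorem mem_of_mem_starEdges (he : e ∈ starEdges k S v) : v ∈ e := by
  obtain ⟨h1, -, h2⟩ := mem_starEdges.1 he
  by_contra hv
  exact h2 ((Finset.subset_insert_iff_of_notMem hv).1 h1)

theorem card_starEdges (hk : k ≠ 0) (hv : v ∉ S) :
    (starEdges k S v).card = S.card.choose (k - 1) := by
  obtain ⟨j, rfl⟩ := Nat.exists_eq_succ_of_ne_zero hk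
  rw [starEdges, Finset.card_sdiff_of_subset
    (Finset.powersetCard_mono (Finset.subset_insert v S)), Finset.card_powersetCard,
    Finset.card_powersetCard, Finset.card_insert_of_notMem hv, Nat.choose_succ_succ]
  simp

theorem starEdges_mono {T : Finset V} (hST : S ⊆ T) (hv : v ∉ T) :
    starEdges k S v ⊆ starEdges k T v := by
  intro e he
  obtain ⟨h1, h2, h3⟩ := mem_starEdges.1 he
  exact mem_starEdges.2 ⟨h1.trans (Finset.insert_subset_insert _ hST), h2,
    fun h => hv (h (mem_of_mem_starEdges he))⟩

end starEdges

/-- The event that `S` is independent and every vertex outside `S` spans at least two edges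
with `S`. -/
def robustIndep {V : Type*} [DecidableEq V] (k : ℕ) (S : Finset V) :
    Set (UniformHypergraph V k) :=
  {H | H.IsIndep S ∧ ∀ v ∉ S, 2 ≤ (starEdges k S v ∩ H.edges).card}

end UniformHypergraph

open UniformHypergraph

/-! ### Probabilities of independence and robust independence -/

theorem setOf_isIndep_eq_edgeCylinder {n k : ℕ} (S : Finset (Fin n)) :
    {H : UniformHypergraph (Fin n) k | H.IsIndep S} = edgeCylinder ∅ (S.powersetCard k) := by
  ext H
  simp [edgeCylinder, isIndep_iff_disjoint]

theorem real_isIndep {n k : ℕ} {p : ℝ} (h0 : 0 ≤ p) (h1 : p ≤ 1) (S : Finset (Fin n)) :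
    (randomHypergraph n k p).real {H | H.IsIndep S} = (1 - p) ^ S.card.choose k := by
  rw [setOf_isIndep_eq_edgeCylinder, randomHypergraph_real_edgeCylinder h0 h1 (by simp)
    (Finset.powersetCard_mono (Finset.subset_univ S)) (by simp)]
  simp

theorem expectedNumIndep_eq {n k : ℕ} {p : ℝ} (h0 : 0 ≤ p) (h1 : p ≤ 1) (s : ℕ) :
    expectedNumIndep n k p s = n.choose s * (1 - p) ^ s.choose k := by
  classical
  have hX : ∀ H : UniformHypergraph (Fin n) k, (H.numIndep s : ℝ) =
      ∑ S ∈ (Finset.univ : Finset (Fin n)).powersetCard s,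
        {H : UniformHypergraph (Fin n) k | H.IsIndep S}.indicator (1 : UniformHypergraph (Fin n) k → ℝ) H := by
    intro H
    have : (Finset.univ.filter fun S : Finset (Fin n) => H.IsIndep S ∧ S.card = s) =
        ((Finset.univ : Finset (Fin n)).powersetCard s).filter fun S => H.IsIndep S := by
      ext S
      simp [Finset.mem_powersetCard, and_comm]
    rw [numIndep, this, Finset.card_filter, Nat.cast_sum]
    refine Finset.sum_congr rfl fun S _ => ?_
    by_cases h : H.IsIndep S <;> simp [h]
  rw [expectedNumIndep, integral_randomHypergraph h0 h1]
  simp only [hX, Finset.mul_sum]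
  rw [Finset.sum_comm]
  simp only [← randomHypergraph_real_eq_sum h0 h1]
  rw [Finset.sum_congr rfl (g := fun _ => (1 - p) ^ s.choose k)]
  · simp
  · intro S hS
    rw [real_isIndep h0 h1, (Finset.mem_powersetCard.1 hS).2]

theorem real_le_indepNum_le {n k : ℕ} {p : ℝ} (h0 : 0 ≤ p) (h1 : p ≤ 1) {s : ℕ} (hs : s ≠ 0) :
    (randomHypergraph n k p).real {H | s ≤ H.indepNum} ≤ n.choose s * (1 - p) ^ s.choose k := by
  have := randomHypergraph_isProbabilityMeasure n k h0 h1
  have hsub : {H : UniformHypergraph (Fin n) k | s ≤ H.indepNum} ⊆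
      ⋃ S ∈ (Finset.univ : Finset (Fin n)).powersetCard s, {H | H.IsIndep S} := by
    intro H hH
    obtain ⟨S, hS, hc⟩ := (le_indepNum_iff H hs).1 hH
    exact Set.mem_biUnion (Finset.mem_powersetCard.2 ⟨Finset.subset_univ _, hc⟩) hS
  refine (measureReal_mono hsub (measure_ne_top _ _)).trans ((measureReal_biUnion_finset_le _ _).trans ?_)
  rw [Finset.sum_congr rfl (g := fun _ => (1 - p) ^ s.choose k)]
  · simp
  · intro S hS
    rw [real_isIndep h0 h1, (Finset.mem_powersetCard.1 hS).2]

/-- Lower bound for the probability of `robustIndep`. -/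
theorem le_real_robustIndep {n k : ℕ} (hk : k ≠ 0) {p : ℝ} (h0 : 0 ≤ p) (h1 : p ≤ 1)
    (S : Finset (Fin n)) :
    (1 - p) ^ S.card.choose k * (1 - n * ((1 - p) ^ S.card.choose (k - 1) +
      S.card.choose (k - 1) * (p * (1 - p) ^ (S.card.choose (k - 1) - 1)))) ≤
      (randomHypergraph n k p).real (robustIndep k S) := by
  classical
  have := randomHypergraph_isProbabilityMeasure n k h0 h1
  set M := S.card.choose (k - 1) with hM
  set a := (1 - p) ^ S.card.choose k
  -- Failure at `v` means that its star has no edge, or exactly one edge `f`. Independence of `S` is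
  -- kept in each bad event, and the star is disjoint from the `k`-subsets of `S`, so the factor `a`
  -- splits off exactly.
  set bad : Fin n → Set (UniformHypergraph (Fin n) k) := fun v =>
    edgeCylinder ∅ (S.powersetCard k ∪ starEdges k S v) ∪
      ⋃ f ∈ starEdges k S v,
        edgeCylinder {f} (S.powersetCard k ∪ (starEdges k S v).erase f) with hbad
  have hsub : {H : UniformHypergraph (Fin n) k | H.IsIndep S} ⊆
      robustIndep k S ∪ ⋃ v ∈ Finset.univ \ S, bad v := by
    intro H hH
    by_cases hr : H ∈ robustIndep k S
    · exact Or.inl hr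
    · right
      have : ∃ v ∉ S, (starEdges k S v ∩ H.edges).card < 2 := by
        by_contra! hcon
        exact hr ⟨hH, hcon⟩
      obtain ⟨v, hv, hlt⟩ := this
      refine Set.mem_biUnion (x := v) (by simpa using hv) ?_
      have hd := (isIndep_iff_disjoint H S).1 hH
      rcases Nat.lt_succ_iff_lt_or_eq.1 hlt with h | h
      · left
        have h' : Disjoint (starEdges k S v) H.edges := by
          rw [Finset.disjoint_iff_inter_eq_empty, ← Finset.card_eq_zero]; omega
        exact ⟨by simp, Finset.disjoint_union_left.2 ⟨hd, h'⟩⟩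
      · right
        obtain ⟨f, hf⟩ := Finset.card_eq_one.1 h
        have hf' : f ∈ starEdges k S v ∩ H.edges := by rw [hf]; simp
        rw [Finset.mem_inter] at hf'
        refine Set.mem_biUnion (x := f) hf'.1 ⟨by simpa using hf'.2,
          Finset.disjoint_union_left.2 ⟨hd, ?_⟩⟩
        rw [Finset.disjoint_left]
        intro g hg hgH
        have : g ∈ starEdges k S v ∩ H.edges := Finset.mem_inter.2 ⟨Finset.mem_of_mem_erase hg, hgH⟩
        rw [hf, Finset.mem_singleton] at this
        exact (Finset.mem_erase.1 hg).1 this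
  have hU1 : S.powersetCard k ⊆ Finset.univ.powersetCard k :=
    Finset.powersetCard_mono (Finset.subset_univ S)
  have hU2 : ∀ v, starEdges k S v ⊆ Finset.univ.powersetCard k := fun v =>
    Finset.sdiff_subset.trans (Finset.powersetCard_mono (Finset.subset_univ _))
  have hdis : ∀ v, Disjoint (S.powersetCard k) (starEdges k S v) := fun v =>
    Finset.disjoint_sdiff
  have hbadle : ∀ v ∈ Finset.univ \ S, (randomHypergraph n k p).real (bad v) ≤
      a * ((1 - p) ^ M + M * (p * (1 - p) ^ (M - 1))) := by
    intro v hv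
    have hvS : v ∉ S := by simpa using hv
    have hcard := card_starEdges hk hvS
    refine (measureReal_union_le _ _).trans ?_
    rw [mul_add]
    refine add_le_add ?_ ?_
    · rw [randomHypergraph_real_edgeCylinder h0 h1 (by simp) (Finset.union_subset hU1 (hU2 v))
        (by simp), Finset.card_union_of_disjoint (hdis v), hcard, Finset.card_powersetCard,
        pow_add]
      simp [a, hM]
    · refine (measureReal_biUnion_finset_le _ _).trans ?_
      rw [Finset.sum_congr rfl (g := fun _ => a * (p * (1 - p) ^ (M - 1)))]
      · rw [Finset.sum_const, hcard, nsmul_eq_mul]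
        exact le_of_eq (by ring)
      · intro f hf
        rw [randomHypergraph_real_edgeCylinder h0 h1, Finset.card_union_of_disjoint,
          Finset.card_erase_of_mem hf, hcard, Finset.card_powersetCard, pow_add]
        · simp [a, hM]; ring
        · exact (hdis v).mono_right (Finset.erase_subset _ _)
        · simpa using (Finset.mem_powersetCard.1 (hU2 v hf)).2
        · exact Finset.union_subset hU1 ((Finset.erase_subset _ _).trans (hU2 v))
        · rw [Finset.disjoint_singleton_left, Finset.mem_union, not_or]
          exact ⟨Finset.disjoint_right.1 (hdis v) hf, Finset.notMem_erase _ _⟩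
  have h := (measureReal_mono (μ := randomHypergraph n k p) hsub).trans (measureReal_union_le _ _)
  rw [real_isIndep h0 h1] at h
  have h2 : (randomHypergraph n k p).real (⋃ v ∈ Finset.univ \ S, bad v) ≤
      n * (a * ((1 - p) ^ M + M * (p * (1 - p) ^ (M - 1)))) := by
    refine (measureReal_biUnion_finset_le _ _).trans ((Finset.sum_le_sum hbadle).trans ?_)
    rw [Finset.sum_const, nsmul_eq_mul]
    have hp : 0 ≤ 1 - p := by linarith
    refine mul_le_mul_of_nonneg_right ?_ (by positivity)
    exact_mod_cast (Finset.card_le_univ _).trans (by simp)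
  have h3 : a * (1 - n * ((1 - p) ^ M + M * (p * (1 - p) ^ (M - 1)))) =
    a - n * (a * ((1 - p) ^ M + M * (p * (1 - p) ^ (M - 1)))) := by ring
  rw [h3]
  linarith

theorem card_powersetCard_union {α : Type*} [DecidableEq α] (S T : Finset α) (k : ℕ) :
    (S.powersetCard k ∪ T.powersetCard k).card =
      S.card.choose k + T.card.choose k - (S ∩ T).card.choose k := by
  rw [Finset.card_union, Finset.card_powersetCard, Finset.card_powersetCard]
  congr 1
  rw [← Finset.card_powersetCard]
  congr 1
  ext e
  simp only [Finset.mem_inter, Finset.mem_powersetCard, Finset.subset_inter_iff]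
  tauto

theorem real_isIndep_inter {n k : ℕ} {p : ℝ} (h0 : 0 ≤ p) (h1 : p ≤ 1) (S T : Finset (Fin n)) :
    (randomHypergraph n k p).real ({H | H.IsIndep S} ∩ {H | H.IsIndep T}) =
      (1 - p) ^ (S.card.choose k + T.card.choose k - (S ∩ T).card.choose k) := by
  classical
  have : ({H : UniformHypergraph (Fin n) k | H.IsIndep S} ∩ {H | H.IsIndep T}) =
      edgeCylinder ∅ (S.powersetCard k ∪ T.powersetCard k) := by
    ext H
    simp [edgeCylinder, isIndep_iff_disjoint, Finset.disjoint_union_left]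
  rw [this, randomHypergraph_real_edgeCylinder h0 h1 (by simp) _ (by simp),
    card_powersetCard_union]
  · simp
  · exact Finset.union_subset (Finset.powersetCard_mono (Finset.subset_univ S))
      (Finset.powersetCard_mono (Finset.subset_univ T))

/-- Upper bound for the joint probability of `robustIndep` for two sets. -/
theorem real_robustIndep_inter_le {n k : ℕ} (hk : k ≠ 0) {p : ℝ} (h0 : 0 ≤ p) (h1 : p ≤ 1)
    (S T : Finset (Fin n)) :
    (randomHypergraph n k p).real (robustIndep k S ∩ robustIndep k T) ≤
      (1 - p) ^ (S.card.choose k + T.card.choose k - (S ∩ T).card.choose k) *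
        ((((S.card.choose (k - 1) - (S ∩ T).card.choose (k - 1) : ℕ) : ℝ) * p) ^ 2) ^
          (T \ S).card := by
  classical
  have := randomHypergraph_isProbabilityMeasure n k h0 h1
  set N := S.card.choose (k - 1) - (S ∩ T).card.choose (k - 1) with hN
  -- A star edge at `v ∈ T \ S` whose other vertices lie in `S ∩ T` is contained in `T`, hence
  -- absent; the two edges promised by robustness of `S` lie in `D v`. Only independence of `T` is
  -- needed.
  set D : Fin n → Finset (Finset (Fin n)) := fun v =>
    starEdges k S v \ starEdges k (S ∩ T) v with hD
  set Φ : Finset (Fin n → Finset (Finset (Fin n))) :=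
    Fintype.piFinset fun v => if v ∈ T \ S then (D v).powersetCard 2 else {∅} with hΦ
  set B := S.powersetCard k ∪ T.powersetCard k with hB
  have hDcard : ∀ v ∈ T \ S, (D v).card = N := by
    intro v hv
    have hv' := (Finset.mem_sdiff.1 hv).2
    have hv'' : v ∉ S ∩ T := fun h => hv' (Finset.mem_inter.1 h).1
    rw [hD, Finset.card_sdiff_of_subset (starEdges_mono Finset.inter_subset_left hv'),
      card_starEdges hk hv', card_starEdges hk hv'']
  have hsub : robustIndep k S ∩ robustIndep k T ⊆
      ⋃ φ ∈ Φ, edgeCylinder (k := k) ((T \ S).biUnion φ) B := by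
    rintro H ⟨⟨hS, hS2⟩, hT, -⟩
    have hch : ∀ v, ∃ F : Finset (Finset (Fin n)), F ⊆ H.edges ∧
        F ∈ (if v ∈ T \ S then (D v).powersetCard 2 else {∅}) := by
      intro v
      by_cases hv : v ∈ T \ S
      · obtain ⟨hvT, hvS⟩ := Finset.mem_sdiff.1 hv
        obtain ⟨F, hF, hF2⟩ := Finset.exists_subset_card_eq (hS2 v hvS)
        refine ⟨F, hF.trans Finset.inter_subset_right, ?_⟩
        rw [if_pos hv, Finset.mem_powersetCard]
        refine ⟨fun e he => ?_, hF2⟩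
        obtain ⟨he1, he2⟩ := Finset.mem_inter.1 (hF he)
        refine Finset.mem_sdiff.2 ⟨he1, fun h => hT e he2 ?_⟩
        exact (mem_starEdges.1 h).1.trans
          (Finset.insert_subset hvT Finset.inter_subset_right)
      · exact ⟨∅, by simp, by simp [hv]⟩
    choose φ hφ1 hφ2 using hch
    refine Set.mem_biUnion (x := φ) (Fintype.mem_piFinset.2 hφ2) ⟨?_, ?_⟩
    · exact Finset.biUnion_subset.2 fun v _ => hφ1 v
    · exact Finset.disjoint_union_left.2
        ⟨(isIndep_iff_disjoint H S).1 hS, (isIndep_iff_disjoint H T).1 hT⟩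
  have hcyl : ∀ φ ∈ Φ, (randomHypergraph n k p).real
      (edgeCylinder (k := k) ((T \ S).biUnion φ) B) = (p ^ 2) ^ (T \ S).card * (1 - p) ^ B.card := by
    intro φ hφ
    have hφ' : ∀ v ∈ T \ S, φ v ⊆ D v ∧ (φ v).card = 2 := by
      intro v hv
      have := Fintype.mem_piFinset.1 hφ v
      rw [if_pos hv] at this
      exact Finset.mem_powersetCard.1 this
    have hmem : ∀ v ∈ T \ S, ∀ e ∈ φ v, e ∈ starEdges k S v ∧ ¬ e ⊆ T := by
      intro v hv e he
      obtain ⟨h1, h2⟩ := Finset.mem_sdiff.1 ((hφ' v hv).1 he)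
      refine ⟨h1, fun heT => h2 ?_⟩
      obtain ⟨h3, h4, h5⟩ := mem_starEdges.1 h1
      refine mem_starEdges.2 ⟨fun x hx => ?_, h4, fun h => h5 (h.trans Finset.inter_subset_left)⟩
      rcases Finset.mem_insert.1 (h3 hx) with h | h
      · exact Finset.mem_insert.2 (Or.inl h)
      · exact Finset.mem_insert_of_mem (Finset.mem_inter.2 ⟨h, heT hx⟩)
    -- A star edge at `v` has `v` as its only vertex outside `S`, so the pairs chosen at different
    -- vertices are disjoint.
    have hcard : ((T \ S).biUnion φ).card = 2 * (T \ S).card := by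
      rw [Finset.card_biUnion, Finset.sum_congr rfl fun v hv => (hφ' v hv).2]
      · simp [mul_comm]
      · intro v hv w hw hvw
        rw [Function.onFun, Finset.disjoint_left]
        intro e hev hew
        have h1 := mem_of_mem_starEdges (hmem v hv e hev).1
        have h2 := (mem_starEdges.1 (hmem w hw e hew).1).1 h1
        rcases Finset.mem_insert.1 h2 with h | h
        · exact hvw h
        · exact (Finset.mem_sdiff.1 hv).2 h
    rw [randomHypergraph_real_edgeCylinder h0 h1, hcard, pow_mul]
    · intro e he
      obtain ⟨v, hv, hev⟩ := Finset.mem_biUnion.1 he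
      simpa using (mem_starEdges.1 (hmem v hv e hev).1).2.1
    · exact Finset.union_subset (Finset.powersetCard_mono (Finset.subset_univ S))
        (Finset.powersetCard_mono (Finset.subset_univ T))
    · rw [Finset.disjoint_left]
      intro e he heB
      obtain ⟨v, hv, hev⟩ := Finset.mem_biUnion.1 he
      obtain ⟨h1, h2⟩ := hmem v hv e hev
      rcases Finset.mem_union.1 heB with h | h
      · exact (mem_starEdges.1 h1).2.2 (Finset.mem_powersetCard.1 h).1
      · exact h2 (Finset.mem_powersetCard.1 h).1
  have hΦcard : (Φ.card : ℝ) ≤ ((N : ℝ) ^ 2) ^ (T \ S).card := by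
    have : Φ.card = (N.choose 2) ^ (T \ S).card := by
      rw [hΦ, Fintype.card_piFinset]
      have : ∀ v, (if v ∈ T \ S then (D v).powersetCard 2 else {∅}).card =
          if v ∈ T \ S then N.choose 2 else 1 := by
        intro v
        by_cases hv : v ∈ T \ S
        · rw [if_pos hv, if_pos hv, Finset.card_powersetCard, hDcard v hv]
        · rw [if_neg hv, if_neg hv, Finset.card_singleton]
      simp only [this]
      rw [Finset.prod_ite_mem, Finset.univ_inter, Finset.prod_const]
    rw [this]
    push_cast
    gcongr
    exact_mod_cast Nat.choose_le_pow N 2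
  refine (measureReal_mono hsub (measure_ne_top _ _)).trans ((measureReal_biUnion_finset_le _ _).trans ?_)
  rw [Finset.sum_congr rfl hcyl, Finset.sum_const, nsmul_eq_mul, hB, card_powersetCard_union]
  have hp : 0 ≤ 1 - p := by linarith
  calc (Φ.card : ℝ) * ((p ^ 2) ^ (T \ S).card *
        (1 - p) ^ (S.card.choose k + T.card.choose k - (S ∩ T).card.choose k))
      ≤ ((N : ℝ) ^ 2) ^ (T \ S).card * ((p ^ 2) ^ (T \ S).card *
        (1 - p) ^ (S.card.choose k + T.card.choose k - (S ∩ T).card.choose k)) := by gcongr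
    _ = _ := by rw [mul_pow, mul_pow]; ring

/-! ### Sums over pairs of sets by intersection size -/

theorem card_filter_card_inter_eq {n : ℕ} (S : Finset (Fin n)) {t l : ℕ} (hl : l ≤ t) :
    (((Finset.univ : Finset (Fin n)).powersetCard t).filter fun T => (S ∩ T).card = l).card =
      S.card.choose l * (n - S.card).choose (t - l) := by
  have : (n - S.card).choose (t - l) = (Sᶜ.powersetCard (t - l)).card := by
    rw [Finset.card_powersetCard, Finset.card_compl, Fintype.card_fin]
  rw [this, ← Finset.card_powersetCard, ← Finset.card_product]
  refine Finset.card_nbij' (fun T => (S ∩ T, T \ S)) (fun x => x.1 ∪ x.2) ?_ ?_ ?_ ?_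
  · intro T hT
    simp only [Finset.coe_filter, Finset.mem_powersetCard, Set.mem_ofPred_eq] at hT
    simp only [Finset.coe_product, Set.mem_prod, Finset.mem_coe, Finset.mem_powersetCard]
    refine ⟨⟨Finset.inter_subset_left, hT.2⟩, fun x hx => ?_, ?_⟩
    · exact Finset.mem_compl.2 (Finset.mem_sdiff.1 hx).2
    · have := Finset.card_inter_add_card_sdiff T S
      rw [Finset.inter_comm] at this
      omega
  · rintro ⟨A, B⟩ h
    simp only [Finset.coe_product, Set.mem_prod, Finset.mem_coe, Finset.mem_powersetCard] at h
    obtain ⟨⟨hA, hAc⟩, hB, hBc⟩ := h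
    have hd : Disjoint A B :=
      (Finset.disjoint_left.2 fun x hx hxB => Finset.mem_compl.1 (hB hxB) (hA hx))
    have hi : S ∩ (A ∪ B) = A := by
      ext x
      have := @hA x
      have := @hB x
      simp only [Finset.mem_compl] at this
      simp only [Finset.mem_inter, Finset.mem_union]
      tauto
    simp only [Finset.coe_filter, Finset.mem_powersetCard, Set.mem_ofPred_eq]
    refine ⟨⟨Finset.subset_univ _, ?_⟩, by rw [hi, hAc]⟩
    rw [Finset.card_union_of_disjoint hd]
    omega
  · intro T _
    ext x
    simp only [Finset.mem_union, Finset.mem_inter, Finset.mem_sdiff]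
    tauto
  · rintro ⟨A, B⟩ h
    simp only [Finset.coe_product, Set.mem_prod, Finset.mem_coe, Finset.mem_powersetCard] at h
    obtain ⟨⟨hA, hAc⟩, hB, hBc⟩ := h
    ext x <;>
    · have h1 := @hA x
      have h2 := @hB x
      simp only [Finset.mem_compl] at h2
      simp only [Finset.mem_inter, Finset.mem_union, Finset.mem_sdiff]
      tauto

theorem sum_powersetCard_card_inter {n : ℕ} (S : Finset (Fin n)) (t : ℕ) (F : ℕ → ℝ) :
    ∑ T ∈ (Finset.univ : Finset (Fin n)).powersetCard t, F (S ∩ T).card =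
      ∑ l ∈ Finset.range (t + 1),
        (S.card.choose l : ℝ) * ((n - S.card).choose (t - l) : ℝ) * F l := by
  rw [← Finset.sum_fiberwise_of_maps_to (t := Finset.range (t + 1))
    (g := fun T => (S ∩ T).card)]
  · refine Finset.sum_congr rfl fun l hl => ?_
    rw [Finset.sum_congr rfl (g := fun _ => F l)
      (fun T hT => by rw [(Finset.mem_filter.1 hT).2]), Finset.sum_const,
      card_filter_card_inter_eq S (Nat.lt_succ_iff.1 (Finset.mem_range.1 hl)), nsmul_eq_mul]
    push_cast
    rfl
  · intro T hT
    rw [Finset.mem_range, Nat.lt_succ_iff, ← (Finset.mem_powersetCard.1 hT).2]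
    exact Finset.card_le_card Finset.inter_subset_right

open Classical in
-- The pair bounds depend only on the intersection size `l`. The predicate `Q` marks where the
-- robustness factor is dropped: for small `l` it may exceed 1.
theorem sum_real_robustIndep_inter_le {n k : ℕ} (hk : k ≠ 0) {p : ℝ} (h0 : 0 ≤ p) (h1 : p ≤ 1)
    (s : ℕ) (Q : ℕ → Prop) :
    ∑ S ∈ (Finset.univ : Finset (Fin n)).powersetCard s,
      ∑ T ∈ (Finset.univ : Finset (Fin n)).powersetCard s,
        (randomHypergraph n k p).real (robustIndep k S ∩ robustIndep k T) ≤
    n.choose s * ∑ l ∈ Finset.range (s + 1), (s.choose l : ℝ) * ((n - s).choose (s - l) : ℝ) *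
      ((1 - p) ^ (s.choose k + s.choose k - l.choose k) * (if Q l then 1 else
        ((((s.choose (k - 1) - l.choose (k - 1) : ℕ) : ℝ) * p) ^ 2) ^ (s - l))) := by
  have := randomHypergraph_isProbabilityMeasure n k h0 h1
  set F : ℕ → ℝ := fun l => (1 - p) ^ (s.choose k + s.choose k - l.choose k) * (if Q l then 1 else
        ((((s.choose (k - 1) - l.choose (k - 1) : ℕ) : ℝ) * p) ^ 2) ^ (s - l)) with hF
  have key : ∀ S ∈ (Finset.univ : Finset (Fin n)).powersetCard s,
      ∑ T ∈ (Finset.univ : Finset (Fin n)).powersetCard s,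
        (randomHypergraph n k p).real (robustIndep k S ∩ robustIndep k T) ≤
      ∑ l ∈ Finset.range (s + 1), (s.choose l : ℝ) * ((n - s).choose (s - l) : ℝ) * F l := by
    intro S hS
    have hSc := (Finset.mem_powersetCard.1 hS).2
    have := sum_powersetCard_card_inter S s F
    rw [hSc] at this
    rw [← this]
    refine Finset.sum_le_sum fun T hT => ?_
    have hTc := (Finset.mem_powersetCard.1 hT).2
    by_cases hQ : Q (S ∩ T).card
    · rw [hF]
      simp only [hQ, if_true, mul_one]
      have h := real_isIndep_inter (k := k) h0 h1 S T
      rw [hSc, hTc] at h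
      rw [← h]
      refine measureReal_mono ?_ (measure_ne_top _ _)
      rintro H ⟨⟨hS, -⟩, hT, -⟩
      exact ⟨hS, hT⟩
    · rw [hF]
      simp only [hQ, if_false]
      have h := real_robustIndep_inter_le hk h0 h1 S T
      have hc : (T \ S).card = s - (S ∩ T).card := by
        rw [Finset.card_sdiff, hTc]
      rw [hSc, hTc, hc] at h
      exact h
  refine (Finset.sum_le_sum key).trans (le_of_eq ?_)
  rw [Finset.sum_const, nsmul_eq_mul, Finset.card_powersetCard, Finset.card_univ,
    Fintype.card_fin]

open Classical in
/-- The second moment bound for `α(H) ≥ s`; pairs of sets whose intersection size satisfies `Q` are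
estimated by independence alone, the others by `robustIndep`. -/
theorem second_moment_bound {n k : ℕ} (hk : k ≠ 0) {p : ℝ} (h0 : 0 ≤ p) (h1 : p < 1)
    {s : ℕ} (hs : s ≠ 0) (hsn : s ≤ n) (Q : ℕ → Prop) {β far near : ℝ} (hβ1 : β ≤ 1)
    (hβ : n * ((1 - p) ^ s.choose (k - 1) +
      s.choose (k - 1) * (p * (1 - p) ^ (s.choose (k - 1) - 1))) ≤ β)
    (hfar : ∑ l ∈ (Finset.range (s + 1)).filter Q,
      (s.choose l : ℝ) * ((n - s).choose (s - l) : ℝ) * ((1 - p) ^ l.choose k)⁻¹ ≤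
        far * n.choose s)
    (hnear : ∑ l ∈ (Finset.range (s + 1)).filter (fun l => ¬ Q l),
      (s.choose l : ℝ) * ((n - s).choose (s - l) : ℝ) * ((1 - p) ^ (s.choose k - l.choose k) *
        ((((s.choose (k - 1) - l.choose (k - 1) : ℕ) : ℝ) * p) ^ 2) ^ (s - l)) ≤ near) :
    (1 - β) ^ 2 ≤ (far + near / expectedNumIndep n k p s) *
      (randomHypergraph n k p).real {H | s ≤ H.indepNum} := by
  have := randomHypergraph_isProbabilityMeasure n k h0 h1.le
  have hq : 0 < 1 - p := by linarith
  set E := expectedNumIndep n k p s with hE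
  have hE' : E = n.choose s * (1 - p) ^ s.choose k := expectedNumIndep_eq h0 h1.le s
  have hC : 0 < (n.choose s : ℝ) := by exact_mod_cast Nat.choose_pos hsn
  have hEpos : 0 < E := by rw [hE']; positivity
  have hsq := sq_sum_real_le h0 h1.le ((Finset.univ : Finset (Fin n)).powersetCard s)
    (robustIndep k)
  have hlow : E * (1 - β) ≤ ∑ S ∈ (Finset.univ : Finset (Fin n)).powersetCard s,
      (randomHypergraph n k p).real (robustIndep k S) := by
    have : ∀ S ∈ (Finset.univ : Finset (Fin n)).powersetCard s,
        (1 - p) ^ s.choose k * (1 - β) ≤ (randomHypergraph n k p).real (robustIndep k S) := by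
      intro S hS
      have h := le_real_robustIndep hk h0 h1.le S
      rw [(Finset.mem_powersetCard.1 hS).2] at h
      refine le_trans ?_ h
      gcongr
    refine le_trans (le_of_eq ?_) (Finset.sum_le_sum this)
    rw [Finset.sum_const, nsmul_eq_mul, hE']
    simp
    ring
  have hup := sum_real_robustIndep_inter_le (n := n) hk h0 h1.le s Q
  have hsplit : n.choose s * ∑ l ∈ Finset.range (s + 1),
      (s.choose l : ℝ) * ((n - s).choose (s - l) : ℝ) *
      ((1 - p) ^ (s.choose k + s.choose k - l.choose k) * (if Q l then 1 else
        ((((s.choose (k - 1) - l.choose (k - 1) : ℕ) : ℝ) * p) ^ 2) ^ (s - l))) ≤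
      E ^ 2 * (far + near / E) := by
    have e : ∀ l ∈ Finset.range (s + 1), l.choose k ≤ s.choose k := fun l hl =>
      Nat.choose_le_choose k (Nat.lt_succ_iff.1 (Finset.mem_range.1 hl))
    rw [← Finset.sum_filter_add_sum_filter_not _ Q, mul_add, mul_add]
    refine add_le_add ?_ ?_
    · calc _ = n.choose s * ((1 - p) ^ s.choose k) ^ 2 *
            ∑ l ∈ (Finset.range (s + 1)).filter Q,
              (s.choose l : ℝ) * ((n - s).choose (s - l) : ℝ) * ((1 - p) ^ l.choose k)⁻¹ := by
            rw [Finset.mul_sum, Finset.mul_sum]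
            refine Finset.sum_congr rfl fun l hl => ?_
            obtain ⟨hl1, hl2⟩ := Finset.mem_filter.1 hl
            rw [if_pos hl2, pow_sub₀ _ hq.ne' ((e l hl1).trans (Nat.le_add_left _ _)), pow_add]
            ring
        _ ≤ n.choose s * ((1 - p) ^ s.choose k) ^ 2 * (far * n.choose s) := by gcongr
        _ = E ^ 2 * far := by rw [hE']; ring
    -- These pairs carry only one factor `E`, so after division by `E ^ 2` they leave `near / E`:
    -- this is why the first moment must tend to infinity.
    · calc _ = n.choose s * (1 - p) ^ s.choose k *
            ∑ l ∈ (Finset.range (s + 1)).filter (fun l => ¬ Q l),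
              (s.choose l : ℝ) * ((n - s).choose (s - l) : ℝ) *
              ((1 - p) ^ (s.choose k - l.choose k) *
              ((((s.choose (k - 1) - l.choose (k - 1) : ℕ) : ℝ) * p) ^ 2) ^ (s - l)) := by
            rw [Finset.mul_sum, Finset.mul_sum]
            refine Finset.sum_congr rfl fun l hl => ?_
            obtain ⟨hl1, hl2⟩ := Finset.mem_filter.1 hl
            rw [if_neg hl2, Nat.add_sub_assoc (e l hl1), pow_add]
            ring
        _ ≤ E * near := by rw [← hE']; gcongr
        _ = E ^ 2 * (near / E) := by field_simp
  have hunion : (randomHypergraph n k p).real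
      (⋃ S ∈ (Finset.univ : Finset (Fin n)).powersetCard s, robustIndep k S) ≤
      (randomHypergraph n k p).real {H | s ≤ H.indepNum} := by
    refine measureReal_mono ?_ (measure_ne_top _ _)
    intro H hH
    obtain ⟨S, hS, hHS⟩ := Set.mem_iUnion₂.1 hH
    exact (le_indepNum_iff H hs).2 ⟨S, hHS.1, (Finset.mem_powersetCard.1 hS).2⟩
  have hchain : (E * (1 - β)) ^ 2 ≤ E ^ 2 * (far + near / E) *
      (randomHypergraph n k p).real {H | s ≤ H.indepNum} := by
    -- `β ≤ 1` makes the first moment bound nonnegative, so that it can be squared.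
    refine (pow_le_pow_left₀ (mul_nonneg hEpos.le (by linarith)) hlow 2).trans (hsq.trans ?_)
    refine mul_le_mul (hup.trans hsplit) hunion measureReal_nonneg ?_
    exact (Finset.sum_nonneg fun S _ => Finset.sum_nonneg fun T _ => measureReal_nonneg).trans
      (hup.trans hsplit)
  rw [mul_pow, mul_assoc] at hchain
  exact le_of_mul_le_mul_left hchain (by positivity)

/-! ### Elementary bounds for binomial coefficients and logarithms -/

/-- Division-free form of C(l,k)/C(s,k) ≤ (l/s)^k, which holds factor by factor since (l-j)/(s-j) ≤
l/s. Taking l = k also yields (s/k)^k ≤ C(s,k). -/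
theorem choose_mul_pow_le {l s : ℕ} (h : l ≤ s) (k : ℕ) :
    l.choose k * s ^ k ≤ s.choose k * l ^ k := by
  induction k with
  | zero => simp
  | succ k ih =>
    refine Nat.le_of_mul_le_mul_right ?_ (Nat.succ_pos k)
    have e1 := Nat.choose_succ_right_eq l k
    have e2 := Nat.choose_succ_right_eq s k
    have h3 : (l - k) * s ≤ (s - k) * l := by
      rw [Nat.sub_mul, Nat.sub_mul, mul_comm l s]
      exact Nat.sub_le_sub_left (Nat.mul_le_mul_left k h) _
    calc l.choose (k + 1) * s ^ (k + 1) * (k + 1)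
        = (l.choose (k + 1) * (k + 1)) * s ^ (k + 1) := by ring
      _ = (l.choose k * s ^ k) * ((l - k) * s) := by rw [e1]; ring
      _ ≤ (s.choose k * l ^ k) * ((s - k) * l) := Nat.mul_le_mul ih h3
      _ = (s.choose (k + 1) * (k + 1)) * l ^ (k + 1) := by rw [e2]; ring
      _ = s.choose (k + 1) * l ^ (k + 1) * (k + 1) := by ring

/-- By Pascal's rule the difference telescopes into `s - l` binomials of order `m`, each at most `s
^ m`. -/
theorem choose_sub_choose_le {l s : ℕ} (h : l ≤ s) (m : ℕ) :
    s.choose (m + 1) - l.choose (m + 1) ≤ (s - l) * s ^ m := by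
  induction s, h using Nat.le_induction with
  | base => simp
  | succ s hs ih =>
    have h1 : (s - l) * s ^ m ≤ (s - l) * (s + 1) ^ m :=
      Nat.mul_le_mul_left _ (Nat.pow_le_pow_left (Nat.le_succ s) m)
    have h2 : s.choose m ≤ (s + 1) ^ m :=
      (Nat.choose_le_pow s m).trans (Nat.pow_le_pow_left (Nat.le_succ s) m)
    have h3 : (s + 1 - l) * (s + 1) ^ m = (s - l) * (s + 1) ^ m + (s + 1) ^ m := by
      rw [show s + 1 - l = (s - l) + 1 by omega]; ring
    rw [Nat.choose_succ_succ', h3]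
    omega

theorem choose_le_exp_mul_div_pow (n : ℕ) {i : ℕ} (hi : i ≠ 0) :
    (n.choose i : ℝ) ≤ (Real.exp 1 * n / i) ^ i := by
  have hi' : (0 : ℝ) < i := by exact_mod_cast Nat.pos_of_ne_zero hi
  have h1 : (n.choose i : ℝ) ≤ (n : ℝ) ^ i / (i.factorial : ℝ) := Nat.choose_le_pow_div i n
  have h2 := Real.pow_div_factorial_le_exp (i : ℝ) hi'.le i
  have hf : (0 : ℝ) < i.factorial := by exact_mod_cast Nat.factorial_pos i
  rw [div_pow, mul_pow, ← Real.exp_nat_mul, mul_one]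
  refine h1.trans ?_
  rw [div_le_div_iff₀ hf (by positivity)]
  rw [div_le_iff₀ hf] at h2
  calc (n : ℝ) ^ i * (i : ℝ) ^ i ≤ (n : ℝ) ^ i * (Real.exp i * i.factorial) := by gcongr
    _ = _ := by ring

/-- C(n-l, s-l) = C(n,s) C(s,l) / C(n,l), and the last ratio is at most (s/n)^l. -/
theorem choose_sub_le_choose_mul {n s l : ℕ} (hl : l ≤ s) (hs : s ≤ n) (hn : n ≠ 0) :
    ((n - s).choose (s - l) : ℝ) ≤ n.choose s * ((s : ℝ) / n) ^ l := by
  have hn' : (0 : ℝ) < n := by exact_mod_cast Nat.pos_of_ne_zero hn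
  have hC : (0 : ℝ) < n.choose l := by exact_mod_cast Nat.choose_pos (hl.trans hs)
  have h1 : ((n - s).choose (s - l) : ℝ) ≤ (n - l).choose (s - l) := by
    exact_mod_cast Nat.choose_le_choose _ (Nat.sub_le_sub_left hl n)
  have h2 : (n.choose s : ℝ) * s.choose l = n.choose l * (n - l).choose (s - l) := by
    exact_mod_cast Nat.choose_mul hl
  have h3 : (s.choose l : ℝ) * (n : ℝ) ^ l ≤ n.choose l * (s : ℝ) ^ l := by
    exact_mod_cast choose_mul_pow_le hs l
  refine h1.trans (le_of_mul_le_mul_left ?_ hC)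
  rw [← h2, div_pow, ← mul_assoc, mul_div_assoc', le_div_iff₀ (by positivity)]
  calc (n.choose s : ℝ) * s.choose l * (n : ℝ) ^ l
      = n.choose s * (s.choose l * (n : ℝ) ^ l) := by ring
    _ ≤ n.choose s * (n.choose l * (s : ℝ) ^ l) := by gcongr
    _ = _ := by ring

/-- The rate `-Real.log (1 - p)` turns powers of `1 - p` into exact exponentials; it lies between
`p` and `2 * p` for 0 ≤ p ≤ 1/2. -/
theorem one_sub_pow_eq_exp {p : ℝ} (hp : p < 1) (m : ℕ) :
    (1 - p) ^ m = Real.exp (-(-Real.log (1 - p) * m)) := by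
  rw [neg_mul, neg_neg, mul_comm, Real.exp_nat_mul, Real.exp_log (by linarith)]

theorem le_neg_log_one_sub {p : ℝ} (hp : p < 1) : p ≤ -Real.log (1 - p) := by
  have := Real.log_le_sub_one_of_pos (show 0 < 1 - p by linarith)
  linarith

theorem neg_log_one_sub_le {p : ℝ} (h0 : 0 ≤ p) (hp : p ≤ 1 / 2) :
    -Real.log (1 - p) ≤ 2 * p := by
  have h := Real.one_sub_inv_le_log_of_pos (show 0 < 1 - p by linarith)
  have h2 : (1 - p)⁻¹ ≤ 1 + 2 * p := by
    rw [inv_le_iff_one_le_mul₀ (by linarith)]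
    nlinarith
  linarith

/-! ### Consequences of the threshold, and single terms of the second moment -/

section Estimates

variable {n k s : ℕ} {p : ℝ}

theorem neg_log_mul_choose_le (hp1 : p < 1) (hn : n ≠ 0)
    (h : 1 ≤ (n.choose s : ℝ) * (1 - p) ^ s.choose k) :
    -Real.log (1 - p) * s.choose k ≤ s * Real.log n := by
  have hn' : (0 : ℝ) < n := by exact_mod_cast Nat.pos_of_ne_zero hn
  rw [one_sub_pow_eq_exp hp1, Real.exp_neg, ← div_eq_mul_inv, one_le_div (Real.exp_pos _)] at h
  have h2 : (n.choose s : ℝ) ≤ (n : ℝ) ^ s := by exact_mod_cast Nat.choose_le_pow n s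
  have h3 : Real.exp (-Real.log (1 - p) * s.choose k) ≤ Real.exp (s * Real.log n) := by
    rw [Real.exp_nat_mul, Real.exp_log hn']
    exact h.trans h2
  exact Real.exp_le_exp.1 h3

/-- Insert C(s,k) ≥ (s/k)^k and cancel one `s`. For `s < k` the binomial vanishes and `h` says
nothing; there `s ^ (k - 1) ≤ k ^ k` suffices. -/
theorem mul_pow_le_of_neg_log_mul_choose_le (hk : k ≠ 0) (h0 : 0 ≤ p) (hp1 : p < 1)
    (hs : s ≠ 0) (hL : 1 ≤ Real.log n)
    (h : -Real.log (1 - p) * s.choose k ≤ s * Real.log n) :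
    p * (s : ℝ) ^ (k - 1) ≤ (k : ℝ) ^ k * Real.log n := by
  have hk1 : (1 : ℝ) ≤ k := by exact_mod_cast Nat.one_le_iff_ne_zero.2 hk
  have hs' : (0 : ℝ) < s := by exact_mod_cast Nat.pos_of_ne_zero hs
  rcases le_or_gt k s with hks | hks
  · have h1 : (s : ℝ) ^ k ≤ s.choose k * (k : ℝ) ^ k := by
      have := choose_mul_pow_le hks k
      rw [Nat.choose_self, one_mul] at this
      exact_mod_cast this
    have h2 : p * (s : ℝ) ^ k ≤ (k : ℝ) ^ k * (s * Real.log n) := by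
      calc p * (s : ℝ) ^ k ≤ p * (s.choose k * (k : ℝ) ^ k) := by gcongr
        _ = (k : ℝ) ^ k * (p * s.choose k) := by ring
        _ ≤ (k : ℝ) ^ k * (-Real.log (1 - p) * s.choose k) := by
          gcongr; exact le_neg_log_one_sub hp1
        _ ≤ _ := by gcongr
    refine le_of_mul_le_mul_right ?_ hs'
    calc p * (s : ℝ) ^ (k - 1) * s = p * (s : ℝ) ^ k := by
          rw [mul_assoc, pow_sub_one_mul hk]
      _ ≤ _ := h2
      _ = _ := by ring
  · have h1 : (s : ℝ) ^ (k - 1) ≤ (k : ℝ) ^ k :=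
      (pow_le_pow_left₀ hs'.le (by exact_mod_cast hks.le) _).trans
        (pow_le_pow_right₀ hk1 (Nat.sub_le k 1))
    calc p * (s : ℝ) ^ (k - 1) ≤ 1 * (k : ℝ) ^ k := by gcongr
      _ = (k : ℝ) ^ k * 1 := by ring
      _ ≤ _ := by gcongr

/-- If the expected number of independent `(s+1)`-sets is at most `x`, adding a vertex to an
independent `s`-set is unlikely. -/
theorem le_neg_log_mul_choose_pred (hk : k ≠ 0) (hp1 : p < 1) (hs : s + 1 ≤ n)
    {x : ℝ} (hx : 1 ≤ x) (h : (n.choose (s + 1) : ℝ) * (1 - p) ^ (s + 1).choose k ≤ x) :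
    k * (Real.log (n / (s + 1)) - Real.log x) ≤ -Real.log (1 - p) * s.choose (k - 1) := by
  set q := -Real.log (1 - p) with hq
  have hn : (0 : ℝ) < n := by exact_mod_cast (Nat.succ_pos s).trans_le hs
  have hs1 : (0 : ℝ) < (s : ℝ) + 1 := by positivity
  have h1 : ((n : ℝ) / (s + 1)) ^ (s + 1) ≤ n.choose (s + 1) := by
    have := choose_mul_pow_le hs (s + 1)
    rw [Nat.choose_self, one_mul] at this
    rw [div_pow, div_le_iff₀ (by positivity)]
    exact_mod_cast this
  rw [one_sub_pow_eq_exp hp1, ← hq] at h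
  have h2 : ((n : ℝ) / (s + 1)) ^ (s + 1) * Real.exp (-(q * (s + 1).choose k)) ≤ x :=
    (mul_le_mul_of_nonneg_right h1 (Real.exp_pos _).le).trans h
  have h3 := Real.log_le_log (by positivity) h2
  rw [Real.log_mul (by positivity) (Real.exp_pos _).ne', Real.log_exp, Real.log_pow] at h3
  push_cast at h3
  have h4 : ((s : ℝ) + 1) * s.choose (k - 1) = (s + 1).choose k * k := by
    have := Nat.add_one_mul_choose_eq s (k - 1)
    rw [Nat.sub_add_cancel (Nat.one_le_iff_ne_zero.2 hk)] at this
    exact_mod_cast this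
  have hlx := Real.log_nonneg hx
  refine le_of_mul_le_mul_left ?_ hs1
  calc ((s : ℝ) + 1) * (k * (Real.log (n / (s + 1)) - Real.log x))
      = k * ((s + 1) * Real.log (n / (s + 1)) - (s + 1) * Real.log x) := by ring
    -- The weaker expression with `(s + 1) * log x` in place of `log x` is used so that `s + 1`
    -- cancels.
    _ ≤ k * ((s + 1) * Real.log (n / (s + 1)) - Real.log x) := by
        gcongr
        have : (0 : ℝ) ≤ s := Nat.cast_nonneg s
        nlinarith
    _ ≤ k * (q * (s + 1).choose k) := by gcongr; linarith
    _ = q * ((s + 1).choose k * k) := by ring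
    _ = q * (((s : ℝ) + 1) * s.choose (k - 1)) := by rw [h4]
    _ = ((s : ℝ) + 1) * (q * s.choose (k - 1)) := by ring

/-- The ratio of consecutive first moments is (n-s-1)/(s+2) · (1-p)^C(s+1,k-1), by Pascal's rule in
the exponent. -/
theorem choose_succ_mul_pow_le (hk : k ≠ 0) (h0 : 0 ≤ p) (hp1 : p < 1) {x y : ℝ}
    (h : (n.choose (s + 1) : ℝ) * (1 - p) ^ (s + 1).choose k ≤ x)
    (hy : y ≤ -Real.log (1 - p) * s.choose (k - 1)) :
    (n.choose (s + 2) : ℝ) * (1 - p) ^ (s + 2).choose k ≤ x * (n / (s + 1) * Real.exp (-y)) := by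
  obtain ⟨j, rfl⟩ := Nat.exists_eq_succ_of_ne_zero hk
  have hs1 : (0 : ℝ) < (s : ℝ) + 1 := by positivity
  have hp : 0 < 1 - p := by linarith
  have h1 : (n.choose (s + 2) : ℝ) ≤ n.choose (s + 1) * (n / (s + 1)) := by
    have e := Nat.choose_succ_right_eq n (s + 1)
    have e' : (n.choose (s + 2) : ℝ) * (s + 1 + 1) = n.choose (s + 1) * ((n - (s + 1) : ℕ) : ℝ) := by
      exact_mod_cast e
    have h2 : ((n - (s + 1) : ℕ) : ℝ) ≤ n := by exact_mod_cast Nat.sub_le n (s + 1)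
    rw [mul_div_assoc', le_div_iff₀ hs1]
    calc (n.choose (s + 2) : ℝ) * (s + 1) ≤ n.choose (s + 2) * (s + 1 + 1) := by gcongr; linarith
      _ ≤ _ := by rw [e']; gcongr
  have h2 : (1 - p) ^ (s + 2).choose (j + 1) ≤
      (1 - p) ^ (s + 1).choose (j + 1) * Real.exp (-y) := by
    rw [Nat.choose_succ_succ (s + 1) j, pow_add, mul_comm]
    refine mul_le_mul_of_nonneg_left ?_ (by positivity)
    calc (1 - p) ^ (s + 1).choose j ≤ (1 - p) ^ s.choose j :=
          pow_le_pow_of_le_one hp.le (by linarith) (Nat.choose_le_choose _ (Nat.le_succ s))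
      _ ≤ _ := by
          rw [one_sub_pow_eq_exp hp1]
          exact Real.exp_le_exp.2 (neg_le_neg hy)
  calc _ ≤ (n.choose (s + 1) * (n / (s + 1))) *
        ((1 - p) ^ (s + 1).choose (j + 1) * Real.exp (-y)) := by gcongr
    _ = (n.choose (s + 1) * (1 - p) ^ (s + 1).choose (j + 1)) * (n / (s + 1) * Real.exp (-y)) := by
      ring
    _ ≤ _ := by gcongr

/-- The left side is the probability that a binomial variable with parameters `M`, `p` is at most 1;
`p ≤ 1 / 2` lets a missing factor `1 - p` be restored at the cost of 2. -/
theorem one_sub_pow_add_le (h0 : 0 ≤ p) (hp : p ≤ 1 / 2) {M : ℕ} {P y : ℝ} (hM : M * p ≤ P)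
    (hy : y ≤ -Real.log (1 - p) * M) :
    (1 - p) ^ M + M * (p * (1 - p) ^ (M - 1)) ≤ (1 + 2 * P) * Real.exp (-y) := by
  have hq : 0 < 1 - p := by linarith
  have h1 : (1 - p) ^ M ≤ Real.exp (-y) := by
    rw [one_sub_pow_eq_exp (by linarith)]
    exact Real.exp_le_exp.2 (neg_le_neg hy)
  have hP : 0 ≤ P := le_trans (by positivity) hM
  have h2 : M * (p * (1 - p) ^ (M - 1)) ≤ 2 * P * (1 - p) ^ M := by
    rcases Nat.eq_zero_or_pos M with rfl | hMpos
    · simp; positivity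
    · have h3 : (1 - p) ^ M = (1 - p) ^ (M - 1) * (1 - p) :=
        (pow_sub_one_mul (Nat.pos_iff_ne_zero.1 hMpos) _).symm
      have h4 : 0 < (1 - p) ^ (M - 1) := by positivity
      calc (M : ℝ) * (p * (1 - p) ^ (M - 1)) = (M * p) * (1 - p) ^ (M - 1) := by ring
        _ ≤ P * (1 - p) ^ (M - 1) := by gcongr
        _ ≤ P * ((1 - p) ^ (M - 1) * (2 * (1 - p))) := by
            gcongr
            exact le_mul_of_one_le_right h4.le (by linarith)
        _ = _ := by rw [h3]; ring
  calc _ ≤ (1 + 2 * P) * (1 - p) ^ M := by linarith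
    _ ≤ _ := by gcongr

/-- Pairs of `s`-sets with large intersection. -/
theorem near_term_le (hk : 2 ≤ k) (h0 : 0 ≤ p) (hp1 : p < 1) (hs : s ≠ 0)
    {η P y : ℝ} (hη0 : 0 < η) (hη1 : η ≤ 1) (hsk : 4 * k ≤ η * s) (hy0 : 0 ≤ y)
    (hy : k * y ≤ -Real.log (1 - p) * s.choose (k - 1)) (hP : p * (s : ℝ) ^ (k - 1) ≤ P)
    {l : ℕ} (hls : l ≤ s) (hl : η * s ≤ l) :
    (s.choose l : ℝ) * ((n - s).choose (s - l) : ℝ) * ((1 - p) ^ (s.choose k - l.choose k) *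
        ((((s.choose (k - 1) - l.choose (k - 1) : ℕ) : ℝ) * p) ^ 2) ^ (s - l)) ≤
      (Real.exp 1 ^ 2 * P ^ 2 * (n / s) * Real.exp (-((1 + η / 2) * y))) ^ (s - l) := by
  rcases hls.eq_or_lt with rfl | hlt
  · simp
  have hs' : (0 : ℝ) < s := by exact_mod_cast Nat.pos_of_ne_zero hs
  have hk0 : (0 : ℝ) < k := by exact_mod_cast (by omega : 0 < k)
  have hp : 0 < 1 - p := by linarith
  set i := s - l with hi
  have hi0 : i ≠ 0 := by omega
  have hi' : (0 : ℝ) < i := by exact_mod_cast Nat.pos_of_ne_zero hi0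
  have hil : (i : ℝ) = s - l := by rw [hi, Nat.cast_sub hls]
  set q := -Real.log (1 - p) with hq
  have hq0 : 0 ≤ q := h0.trans (le_neg_log_one_sub hp1)
  have c1 : (s.choose l : ℝ) ≤ (Real.exp 1 * s / i) ^ i := by
    rw [← Nat.choose_symm hls]
    exact choose_le_exp_mul_div_pow s hi0
  have c2 : ((n - s).choose i : ℝ) ≤ (Real.exp 1 * n / i) ^ i := by
    refine le_trans ?_ (choose_le_exp_mul_div_pow n hi0)
    exact_mod_cast Nat.choose_le_choose _ (Nat.sub_le n s)
  have c3 : ((s.choose (k - 1) - l.choose (k - 1) : ℕ) : ℝ) * p ≤ i * P / s := by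
    have e : k - 1 = (k - 2) + 1 := by omega
    have h1 : ((s.choose (k - 1) - l.choose (k - 1) : ℕ) : ℝ) ≤ i * (s : ℝ) ^ (k - 2) := by
      rw [e]
      exact_mod_cast choose_sub_choose_le hls (k - 2)
    rw [le_div_iff₀ hs']
    calc ((s.choose (k - 1) - l.choose (k - 1) : ℕ) : ℝ) * p * s
        ≤ i * (s : ℝ) ^ (k - 2) * p * s := by gcongr
      _ = i * (p * (s : ℝ) ^ (k - 1)) := by rw [e, pow_succ]; ring
      _ ≤ i * P := by gcongr
  have c4 : (1 - p) ^ (s.choose k - l.choose k) ≤ Real.exp (-((1 + η / 2) * y)) ^ i := by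
    rw [one_sub_pow_eq_exp hp1, ← Real.exp_nat_mul, ← hq,
      Nat.cast_sub (Nat.choose_le_choose k hls)]
    refine Real.exp_le_exp.2 ?_
    have h1 : (s.choose k : ℝ) * k = s.choose (k - 1) * (s - (k - 1)) := by
      have := Nat.choose_succ_right_eq s (k - 1)
      rw [Nat.sub_add_cancel (by omega : 1 ≤ k)] at this
      have hks : k - 1 ≤ s := by
        have : (k : ℝ) ≤ s := by nlinarith
        have : k ≤ s := by exact_mod_cast this
        omega
      have h := congrArg (Nat.cast : ℕ → ℝ) this
      push_cast [Nat.cast_sub hks, Nat.cast_sub (by omega : 1 ≤ k)] at h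
      exact h
    -- `4 * k ≤ η * s` makes the correction `k - 1` at most `η * s / 4`.
    have hsk1 : (1 - η / 4) * s ≤ s - (k - 1) := by linarith
    have h2 : y * ((1 - η / 4) * s) ≤ q * s.choose k := by
      refine le_of_mul_le_mul_left ?_ hk0
      calc k * (y * ((1 - η / 4) * s)) = (k * y) * ((1 - η / 4) * s) := by ring
        _ ≤ (q * s.choose (k - 1)) * (s - (k - 1)) := by
            refine mul_le_mul hy hsk1 ?_ (by positivity)
            exact mul_nonneg (by linarith) hs'.le
        _ = k * (q * s.choose k) := by linear_combination -q * h1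
    -- Exponent 2 suffices for every `k ≥ 2`: 1 - (l/s)² = (i/s)(1 + l/s), and 1 + l/s ≥ 1 + η is
    -- the gain that later beats `n / s`.
    have h3 : (l.choose k : ℝ) ≤ s.choose k * ((l : ℝ) / s) ^ 2 := by
      have h4 : (l.choose k : ℝ) * (s : ℝ) ^ k ≤ s.choose k * (l : ℝ) ^ k := by
        exact_mod_cast choose_mul_pow_le hls k
      have h5 : ((l : ℝ) / s) ^ k ≤ ((l : ℝ) / s) ^ 2 := by
        refine pow_le_pow_of_le_one (by positivity) ?_ hk
        rw [div_le_one hs']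
        exact_mod_cast hls
      refine le_trans ?_ (mul_le_mul_of_nonneg_left h5 (Nat.cast_nonneg _))
      rw [div_pow, mul_div_assoc', le_div_iff₀ (by positivity)]
      exact h4
    have hlr : (η : ℝ) ≤ l / s := by rwa [le_div_iff₀ hs']
    have h6 : (1 - ((l : ℝ) / s) ^ 2) = i / s * (1 + l / s) := by
      rw [hil]; field_simp; ring
    have h7 : i * ((1 + η / 2) * y) ≤ q * (s.choose k - l.choose k) := by
      calc i * ((1 + η / 2) * y) ≤ i * (((1 - η / 4) * (1 + η)) * y) := by
            gcongr; nlinarith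
        _ = (y * ((1 - η / 4) * s)) * (i / s * (1 + η)) := by field_simp
        _ ≤ (q * s.choose k) * (i / s * (1 + l / s)) := by gcongr
        _ = q * (s.choose k - s.choose k * ((l : ℝ) / s) ^ 2) := by rw [← h6]; ring
        _ ≤ _ := by gcongr
    linarith
  -- The `i`-dependence of the base cancels: (es/i)(en/i)(iP/s)² = e²P²n/s. With one edge per vertex
  -- instead of two, an excess factor of order s/i would remain.
  calc _ ≤ (Real.exp 1 * s / i) ^ i * (Real.exp 1 * n / i) ^ i *
        (Real.exp (-((1 + η / 2) * y)) ^ i * ((i * P / s) ^ 2) ^ i) := by gcongr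
    _ = _ := by
      rw [← mul_pow, ← mul_pow, ← mul_pow]
      congr 1
      field_simp

/-- Pairs of `s`-sets with small intersection. -/
theorem far_term_le (hk : 2 ≤ k) (h0 : 0 ≤ p) (hp1 : p < 1) (hs : s ≠ 0) (hsn : s ≤ n)
    {η : ℝ}
    (hup : -Real.log (1 - p) * s.choose k ≤ s * Real.log n)
    {l : ℕ} (hls : l ≤ s) (hl0 : l ≠ 0) (hl : l ≤ η * s)
    (hl2 : Real.exp (2 * η * Real.log n) * (s : ℝ) ^ 2 / n ≤ l) :
    (s.choose l : ℝ) * ((n - s).choose (s - l) : ℝ) * ((1 - p) ^ l.choose k)⁻¹ ≤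
      (Real.exp 1 * Real.exp (-(η * Real.log n))) ^ l * n.choose s := by
  have hs' : (0 : ℝ) < s := by exact_mod_cast Nat.pos_of_ne_zero hs
  have hl' : (0 : ℝ) < l := by exact_mod_cast Nat.pos_of_ne_zero hl0
  have hn : n ≠ 0 := by omega
  have hn' : (0 : ℝ) < n := by exact_mod_cast Nat.pos_of_ne_zero hn
  set q := -Real.log (1 - p) with hq
  have hq0 : 0 ≤ q := h0.trans (le_neg_log_one_sub hp1)
  have c1 := choose_le_exp_mul_div_pow s hl0
  have c2 := choose_sub_le_choose_mul hls hsn hn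
  have c3 : ((1 - p) ^ l.choose k)⁻¹ ≤ Real.exp (η * Real.log n) ^ l := by
    rw [one_sub_pow_eq_exp hp1, ← Real.exp_neg, neg_neg, ← Real.exp_nat_mul, ← hq]
    refine Real.exp_le_exp.2 ?_
    have h3 : (l.choose k : ℝ) ≤ s.choose k * ((l : ℝ) / s) ^ 2 := by
      have h4 : (l.choose k : ℝ) * (s : ℝ) ^ k ≤ s.choose k * (l : ℝ) ^ k := by
        exact_mod_cast choose_mul_pow_le hls k
      have h5 : ((l : ℝ) / s) ^ k ≤ ((l : ℝ) / s) ^ 2 := by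
        refine pow_le_pow_of_le_one (by positivity) ?_ hk
        rw [div_le_one hs']
        exact_mod_cast hls
      refine le_trans ?_ (mul_le_mul_of_nonneg_left h5 (Nat.cast_nonneg _))
      rw [div_pow, mul_div_assoc', le_div_iff₀ (by positivity)]
      exact h4
    have hlr : (l : ℝ) / s ≤ η := by rwa [div_le_iff₀ hs']
    calc q * l.choose k ≤ q * (s.choose k * ((l : ℝ) / s) ^ 2) := by gcongr
      _ = (q * s.choose k) * ((l : ℝ) / s) ^ 2 := by ring
      _ ≤ (s * Real.log n) * ((l : ℝ) / s) ^ 2 := by gcongr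
      _ = l * (l / s * Real.log n) := by field_simp
      _ ≤ l * (η * Real.log n) := by gcongr
  -- `hl2` says s²/(ln) ≤ n^(-2η); the inverse power of `1 - p` gives back only n^η per vertex.
  have c4 : Real.exp 1 * s / l * (s / n) * Real.exp (η * Real.log n) ≤
      Real.exp 1 * Real.exp (-(η * Real.log n)) := by
    have e : Real.exp (2 * η * Real.log n) =
        Real.exp (η * Real.log n) * Real.exp (η * Real.log n) := by
      rw [← Real.exp_add]; ring_nf
    rw [Real.exp_neg]
    rw [e, div_le_iff₀ hn'] at hl2
    set z := Real.exp (η * Real.log n) with hz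
    have hz0 : 0 < z := Real.exp_pos _
    rw [← div_eq_mul_inv, le_div_iff₀ hz0]
    have : Real.exp 1 * s / l * (s / n) * z * z = Real.exp 1 * ((z * z * s ^ 2) / (l * n)) := by
      field_simp
    rw [this]
    refine mul_le_of_le_one_right (Real.exp_pos _).le ?_
    rwa [div_le_one (by positivity)]
  calc _ ≤ (Real.exp 1 * s / l) ^ l * (n.choose s * ((s : ℝ) / n) ^ l) *
        Real.exp (η * Real.log n) ^ l := by
        have : 0 < 1 - p := by linarith
        gcongr
    _ = (Real.exp 1 * s / l * (s / n) * Real.exp (η * Real.log n)) ^ l * n.choose s := by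
        rw [mul_pow, mul_pow]; ring
    _ ≤ _ := by gcongr

end Estimates

/-! ### Summation over intersection sizes -/

theorem sum_range_pow_le_two {r : ℝ} (h0 : 0 ≤ r) (h : r ≤ 1 / 2) (m : ℕ) :
    ∑ i ∈ Finset.range m, r ^ i ≤ 2 := by
  have hs := hasSum_geometric_of_lt_one h0 (by linarith)
  refine (sum_le_hasSum _ (fun i _ => pow_nonneg h0 i) hs).trans ?_
  rw [inv_le_comm₀ (by linarith) (by norm_num)]
  linarith

section Sums

variable {n k s : ℕ} {p : ℝ}

open Classical in
theorem near_sum_le (hk : 2 ≤ k) (h0 : 0 ≤ p) (hp1 : p < 1) (hs : s ≠ 0)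
    {η P y : ℝ} (hη0 : 0 < η) (hη1 : η ≤ 1) (hsk : 4 * k ≤ η * s) (hy0 : 0 ≤ y)
    (hy : k * y ≤ -Real.log (1 - p) * s.choose (k - 1)) (hP : p * (s : ℝ) ^ (k - 1) ≤ P)
    (hb : Real.exp 1 ^ 2 * P ^ 2 * (n / s) * Real.exp (-((1 + η / 2) * y)) ≤ 1 / 2) :
    ∑ l ∈ (Finset.range (s + 1)).filter (fun l : ℕ => ¬ (l : ℝ) < η * s),
      (s.choose l : ℝ) * ((n - s).choose (s - l) : ℝ) * ((1 - p) ^ (s.choose k - l.choose k) *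
        ((((s.choose (k - 1) - l.choose (k - 1) : ℕ) : ℝ) * p) ^ 2) ^ (s - l)) ≤ 2 := by
  set b := Real.exp 1 ^ 2 * P ^ 2 * (n / s) * Real.exp (-((1 + η / 2) * y)) with hbdef
  have hb0 : 0 ≤ b := by positivity
  calc _ ≤ ∑ l ∈ (Finset.range (s + 1)).filter (fun l : ℕ => ¬ (l : ℝ) < η * s), b ^ (s - l) := by
        refine Finset.sum_le_sum fun l hl => ?_
        obtain ⟨h1, h2⟩ := Finset.mem_filter.1 hl
        exact near_term_le hk h0 hp1 hs hη0 hη1 hsk hy0 hy hP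
          (Nat.lt_succ_iff.1 (Finset.mem_range.1 h1)) (not_lt.1 h2)
    _ ≤ ∑ l ∈ Finset.range (s + 1), b ^ (s - l) :=
        Finset.sum_le_sum_of_subset_of_nonneg (Finset.filter_subset _ _)
          fun l _ _ => pow_nonneg hb0 _
    _ = ∑ l ∈ Finset.range (s + 1), b ^ l := Finset.sum_flip _
    _ ≤ 2 := sum_range_pow_le_two hb0 hb _

theorem sum_choose_mul_choose (hsn : s ≤ n) :
    ∑ l ∈ Finset.range (s + 1), (s.choose l : ℝ) * ((n - s).choose (s - l) : ℝ) =
      n.choose s := by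
  have h := Nat.add_choose_eq s (n - s) s
  rw [Nat.add_sub_cancel' hsn, Finset.Nat.sum_antidiagonal_eq_sum_range_succ_mk] at h
  rw [h]
  push_cast
  rfl

open Classical in
-- Below l₀ = n^(2η) s²/n the correlation factor is at most `exp κ`, and Vandermonde's identity sums
-- the weights to C(n,s). From l₀ on the terms are geometric. The case `l = 0` is kept apart so that
-- the geometric part starts at `r`, which tends to 0.
theorem far_sum_le (hk : 2 ≤ k) (h0 : 0 ≤ p) (hp1 : p ≤ 1 / 2) (hs : s ≠ 0) (hsn : s ≤ n)
    {η κ : ℝ} (hup : -Real.log (1 - p) * s.choose k ≤ s * Real.log n)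
    (hκ : 2 * p * (Real.exp (2 * η * Real.log n) * (s : ℝ) ^ 2 / n) ^ k ≤ κ)
    (hr : Real.exp 1 * Real.exp (-(η * Real.log n)) ≤ 1 / 2) :
    ∑ l ∈ (Finset.range (s + 1)).filter (fun l : ℕ => (l : ℝ) < η * s),
      (s.choose l : ℝ) * ((n - s).choose (s - l) : ℝ) * ((1 - p) ^ l.choose k)⁻¹ ≤
      (Real.exp κ + 2 * (Real.exp 1 * Real.exp (-(η * Real.log n)))) * n.choose s := by
  set r := Real.exp 1 * Real.exp (-(η * Real.log n)) with hrdef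
  set l₀ := Real.exp (2 * η * Real.log n) * (s : ℝ) ^ 2 / n with hl₀
  have hr0 : 0 ≤ r := by positivity
  have hl₀0 : 0 ≤ l₀ := by positivity
  have hκ0 : 0 ≤ κ := le_trans (by positivity) hκ
  have hp : 0 < 1 - p := by linarith
  set a : ℕ → ℝ := fun l => (s.choose l : ℝ) * ((n - s).choose (s - l) : ℝ) with ha
  have ha0 : ∀ l, 0 ≤ a l := fun l => by positivity
  have hterm : ∀ l ∈ (Finset.range (s + 1)).filter (fun l : ℕ => (l : ℝ) < η * s),
      a l * ((1 - p) ^ l.choose k)⁻¹ ≤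
        a l * Real.exp κ + (if l = 0 then 0 else r ^ l) * n.choose s := by
    intro l hl
    obtain ⟨h1, h2⟩ := Finset.mem_filter.1 hl
    have hls := Nat.lt_succ_iff.1 (Finset.mem_range.1 h1)
    by_cases hl0 : l = 0
    · subst hl0
      rw [if_pos rfl, zero_mul, add_zero, Nat.choose_eq_zero_of_lt (by omega), pow_zero, inv_one]
      exact mul_le_mul_of_nonneg_left (Real.one_le_exp hκ0) (ha0 0)
    rw [if_neg hl0]
    rcases le_or_gt l₀ l with h3 | h3
    · have := far_term_le hk h0 (by linarith) hs hsn hup hls hl0 h2.le h3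
      refine this.trans (le_add_of_nonneg_left ?_)
      exact mul_nonneg (ha0 l) (Real.exp_pos _).le
    · have h4 : ((1 - p) ^ l.choose k)⁻¹ ≤ Real.exp κ := by
        rw [one_sub_pow_eq_exp (by linarith), ← Real.exp_neg, neg_neg]
        refine Real.exp_le_exp.2 (le_trans ?_ hκ)
        have h5 : (l.choose k : ℝ) ≤ l₀ ^ k :=
          (by exact_mod_cast Nat.choose_le_pow l k : (l.choose k : ℝ) ≤ (l : ℝ) ^ k).trans
            (pow_le_pow_left₀ (Nat.cast_nonneg _) h3.le k)
        have h6 := neg_log_one_sub_le h0 hp1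
        exact mul_le_mul h6 h5 (Nat.cast_nonneg _) (by linarith)
      refine le_trans (mul_le_mul_of_nonneg_left h4 (ha0 l)) (le_add_of_nonneg_right ?_)
      positivity
  have hgeo : ∑ l ∈ Finset.range (s + 1), (if l = 0 then 0 else r ^ l) ≤ 2 * r := by
    rw [Finset.sum_range_succ', if_pos rfl, add_zero]
    have : ∀ l, (if l + 1 = 0 then 0 else r ^ (l + 1)) = r ^ l * r := fun l => by
      rw [if_neg (Nat.succ_ne_zero l), pow_succ]
    simp only [this]
    rw [← Finset.sum_mul]
    exact mul_le_mul_of_nonneg_right (sum_range_pow_le_two hr0 hr _) hr0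
  calc _ ≤ ∑ l ∈ (Finset.range (s + 1)).filter (fun l : ℕ => (l : ℝ) < η * s),
        (a l * Real.exp κ + (if l = 0 then 0 else r ^ l) * n.choose s) := Finset.sum_le_sum hterm
    _ ≤ ∑ l ∈ Finset.range (s + 1),
        (a l * Real.exp κ + (if l = 0 then 0 else r ^ l) * n.choose s) := by
        refine Finset.sum_le_sum_of_subset_of_nonneg (Finset.filter_subset _ _) fun l _ _ => ?_
        have := ha0 l
        split_ifs <;> positivity
    _ = n.choose s * Real.exp κ +
        (∑ l ∈ Finset.range (s + 1), (if l = 0 then 0 else r ^ l)) * n.choose s := by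
        rw [Finset.sum_add_distrib, ← Finset.sum_mul, ← Finset.sum_mul, sum_choose_mul_choose hsn]
    _ ≤ n.choose s * Real.exp κ + (2 * r) * n.choose s := by gcongr
    _ = _ := by ring

end Sums

/-! ### The threshold and the bound for fixed `n` -/

/-- Singletons contain no `k`-set, so E[X_1] = n passes the threshold, while E[X_s] = 0 for s > n.
Thus the set is nonempty and bounded, and its `sSup` is a positive maximum. -/
theorem isGreatest_expectationThreshold {n k : ℕ} (hk : 2 ≤ k) {p ε : ℝ} (h0 : 0 ≤ p)
    (h1 : p ≤ 1) (hx0 : 0 ≤ ε * Real.log n) (hx : ε * Real.log n < n) :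
    IsGreatest (thresholdSizes n k p ε) (expectationThreshold n k p ε) ∧
      expectationThreshold n k p ε ≠ 0 := by
  have hmem : 1 ∈ thresholdSizes n k p ε := by
    simp only [thresholdSizes, Set.mem_ofPred_eq, expectedNumIndep_eq h0 h1,
      Nat.choose_eq_zero_of_lt hk]
    simpa using hx
  have hbdd : BddAbove (thresholdSizes n k p ε) := by
    refine ⟨n, fun s hs => ?_⟩
    by_contra! hns
    simp only [thresholdSizes, Set.mem_ofPred_eq, expectedNumIndep_eq h0 h1,
      Nat.choose_eq_zero_of_lt hns] at hs
    simp at hs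
    linarith
  refine ⟨⟨Nat.sSup_mem ⟨1, hmem⟩ hbdd, fun s hs => le_csSup hbdd hs⟩, ?_⟩
  have : 1 ≤ expectationThreshold n k p ε := le_csSup hbdd hmem
  omega

/-- Here the lower bound on `p` enters: `hP` gives (k-1) log s ≤ ((k-1)²/k - ε) log n plus
lower-order terms, which half of `ε` absorbs. -/
theorem log_threshold_le {n k s : ℕ} (hk : 2 ≤ k) {p ε : ℝ} (h0 : 0 < p) (hs : s ≠ 0)
    (hL : 1 ≤ Real.log n)
    (hp : (n : ℝ) ^ (-(((k : ℝ) - 1) ^ 2 / (k : ℝ)) + ε) < p)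
    (hlog : ((k : ℝ) - 1) * Real.log 2 + Real.log ((k : ℝ) ^ k * Real.log n) ≤
      ε / 2 * Real.log n)
    (hP : p * (s : ℝ) ^ (k - 1) ≤ (k : ℝ) ^ k * Real.log n) :
    Real.log (s + 1) ≤ (1 - 1 / k - ε / (2 * (k - 1))) * Real.log n := by
  have hs1 : (1 : ℝ) ≤ s := by exact_mod_cast Nat.one_le_iff_ne_zero.2 hs
  have hk2 : (2 : ℝ) ≤ k := by exact_mod_cast hk
  have hk1 : (0 : ℝ) < (k : ℝ) - 1 := by linarith
  have hn : (0 : ℝ) < n := by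
    by_contra h
    have : (n : ℝ) = 0 := le_antisymm (not_lt.1 h) (Nat.cast_nonneg n)
    rw [this, Real.log_zero] at hL
    linarith
  have h1 := Real.log_le_log (by positivity) hP
  rw [Real.log_mul h0.ne' (by positivity), Real.log_pow, Nat.cast_sub (by omega)] at h1
  push_cast at h1
  have h2 := Real.log_lt_log (by positivity) hp
  rw [Real.log_rpow hn] at h2
  have h3 : Real.log (s + 1) ≤ Real.log 2 + Real.log s := by
    rw [← Real.log_mul (by norm_num) (by positivity)]
    exact Real.log_le_log (by positivity) (by linarith)
  refine le_of_mul_le_mul_left ?_ hk1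
  have e : ((k : ℝ) - 1) * ((1 - 1 / k - ε / (2 * (k - 1))) * Real.log n) =
      (((k : ℝ) - 1) ^ 2 / k) * Real.log n - ε / 2 * Real.log n := by
    field_simp
  rw [e]
  nlinarith

/-- As p → 0 the threshold outgrows any constant `S`: for `s ≤ S` the exponent would be at most
2pS^(k-1) < 1. -/
theorem threshold_large {k s S : ℕ} {p y : ℝ} (h0 : 0 ≤ p) (hp1 : p ≤ 1 / 2)
    (hy : 1 ≤ y) (h : y ≤ -Real.log (1 - p) * s.choose (k - 1))
    (hS : 2 * p * (S : ℝ) ^ (k - 1) < 1) : S < s := by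
  by_contra! hle
  have h1 : (s.choose (k - 1) : ℝ) ≤ (S : ℝ) ^ (k - 1) :=
    (by exact_mod_cast Nat.choose_le_pow s (k - 1) :
      (s.choose (k - 1) : ℝ) ≤ (s : ℝ) ^ (k - 1)).trans
      (pow_le_pow_left₀ (Nat.cast_nonneg _) (by exact_mod_cast hle) _)
  have := mul_le_mul (neg_log_one_sub_le h0 hp1) h1 (Nat.cast_nonneg _) (by linarith)
  linarith

/-- Error term for the vertices outside an independent set, as a function of `log n`. -/
noncomputable def robustError (k : ℕ) (ε x : ℝ) : ℝ :=
  (1 + 2 * ((k : ℝ) ^ k * x)) * (ε * x) ^ k * Real.exp (-(k * (ε / (2 * (k - 1))) * x))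

/-- Bound for the normalized second moment, as a function of `log n`. -/
noncomputable def secondMomentRatio (k : ℕ) (ε x : ℝ) : ℝ :=
  Real.exp (2 * ((k : ℝ) ^ k * x) * Real.exp (-(1 / (2 * k) * x))) +
    2 * (Real.exp 1 * Real.exp (-(1 / (4 * (k : ℝ) ^ 2) * x))) + 2 / (ε * x)

/-- Bound for the first moment two steps above the threshold, as a function of `log n`. -/
noncomputable def firstMomentError (k : ℕ) (ε x : ℝ) : ℝ :=
  (ε * x) ^ (k + 1) * Real.exp (-(1 / k * x))

set_option maxHeartbeats 1000000 in
-- All hypotheses hold for large `n`, and the errors depend on `n` only through `log n`, so the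
-- limit becomes a question about functions of one real variable.
theorem le_real_indepNum_eq_threshold {n k : ℕ} (hk : 2 ≤ k) {p ε : ℝ} (hε : 0 < ε) (h0 : 0 < p)
    (hp1 : p ≤ 1 / 2) (hp : (n : ℝ) ^ (-(((k : ℝ) - 1) ^ 2 / (k : ℝ)) + ε) < p)
    (hL : 1 ≤ Real.log n) (hx1 : 1 ≤ ε * Real.log n) (hxn : ε * Real.log n < n)
    (hlog : ((k : ℝ) - 1) * Real.log 2 + Real.log ((k : ℝ) ^ k * Real.log n) ≤
      ε / 2 * Real.log n)
    (hΛ : 1 ≤ 1 / k * Real.log n - Real.log (ε * Real.log n))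
    (hS : 2 * p * ((16 * k ^ 3 : ℕ) : ℝ) ^ (k - 1) < 1)
    (hb : 2 * Real.exp 1 ^ 2 * ((k : ℝ) ^ k * Real.log n) ^ 2 * (ε * Real.log n) ^ 2 *
      Real.exp (-(1 / (8 * (k : ℝ) ^ 3) * Real.log n)) ≤ 1 / 2)
    (hr : Real.exp 1 * Real.exp (-(1 / (4 * (k : ℝ) ^ 2) * Real.log n)) ≤ 1 / 2)
    (hβ : robustError k ε (Real.log n) ≤ 1) :
    (1 - robustError k ε (Real.log n)) ^ 2 / secondMomentRatio k ε (Real.log n) -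
        firstMomentError k ε (Real.log n) ≤
      (randomHypergraph n k p).real
        {H | H.indepNum = expectationThreshold n k p ε ∨
          H.indepNum = expectationThreshold n k p ε + 1} := by
  have hpr := randomHypergraph_isProbabilityMeasure n k h0.le (by linarith : p ≤ 1)
  have hk0 : k ≠ 0 := by omega
  have hk2 : (2 : ℝ) ≤ k := by exact_mod_cast hk
  have hkpos : (0 : ℝ) < k := by linarith
  have hk1 : (0 : ℝ) < (k : ℝ) - 1 := by linarith
  obtain ⟨hgreat, hs0⟩ := isGreatest_expectationThreshold hk h0.le (by linarith : p ≤ 1)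
    (by linarith) hxn
  set s := expectationThreshold n k p ε with hs
  set L := Real.log n with hLdef
  set X := ε * L with hX
  have hXpos : 0 < X := by linarith
  have hn0 : n ≠ 0 := by
    rintro rfl
    simp [hLdef] at hL
    linarith
  have hn : (0 : ℝ) < n := by exact_mod_cast Nat.pos_of_ne_zero hn0
  have hexpL : Real.exp L = n := Real.exp_log hn
  have hs' : (0 : ℝ) < s := by exact_mod_cast Nat.pos_of_ne_zero hs0
  have hE1 : X < n.choose s * (1 - p) ^ s.choose k := by
    have := hgreat.1
    rwa [thresholdSizes, Set.mem_ofPred_eq, expectedNumIndep_eq h0.le (by linarith)] at this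
  have hE2 : n.choose (s + 1) * (1 - p) ^ (s + 1).choose k ≤ X := by
    by_contra! h
    have : s + 1 ∈ thresholdSizes n k p ε := by
      rwa [thresholdSizes, Set.mem_ofPred_eq, expectedNumIndep_eq h0.le (by linarith)]
    have := hgreat.2 this
    omega
  have hup := neg_log_mul_choose_le (by linarith : p < 1) hn0 (hx1.trans hE1.le)
  set P := (k : ℝ) ^ k * L with hPdef
  have hP0 : 0 < P := by positivity
  have hP : p * (s : ℝ) ^ (k - 1) ≤ P :=
    mul_pow_le_of_neg_log_mul_choose_le hk0 h0.le (by linarith) hs0 hL hup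
  have hsize := log_threshold_le hk h0 hs0 hL hp hlog hP
  set c := ε / (2 * ((k : ℝ) - 1)) with hc
  have hc0 : 0 < c := by positivity
  have hcL : 0 < c * L := by positivity
  have hkL : 0 < 1 / k * L := by positivity
  have hsn : s + 1 ≤ n := by
    have : Real.log ((s : ℝ) + 1) ≤ Real.log n := by linarith
    have := (Real.log_le_log_iff (by positivity) hn).1 this
    exact_mod_cast this
  set t := Real.log (n / ((s : ℝ) + 1)) with ht
  have htL : (1 / k + c) * L ≤ t := by
    rw [ht, Real.log_div hn.ne' (by positivity)]
    linarith
  have htL' : 1 / k * L ≤ t := by linarith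
  have hexpt : Real.exp t = n / ((s : ℝ) + 1) := Real.exp_log (by positivity)
  set Λ := Real.log X with hΛdef
  have hΛ0 : 0 ≤ Λ := Real.log_nonneg hx1
  have hexpΛ : Real.exp Λ = X := Real.exp_log hXpos
  have hy : k * (t - Λ) ≤ -Real.log (1 - p) * s.choose (k - 1) :=
    le_neg_log_mul_choose_pred hk0 (by linarith : p < 1) hsn hx1 hE2
  have hy1 : 1 ≤ t - Λ := by linarith
  have hlarge : 16 * k ^ 3 < s := by
    refine threshold_large h0.le hp1 (y := k * (t - Λ)) ?_ hy hS
    exact one_le_mul_of_one_le_of_one_le (by linarith) hy1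
  have hexpy : Real.exp (-(k * (t - Λ))) = Real.exp (-(k * t)) * X ^ k := by
    rw [← hexpΛ, ← Real.exp_nat_mul, ← Real.exp_add]
    ring_nf
  have hM : (s.choose (k - 1) : ℝ) * p ≤ P := by
    refine le_trans ?_ hP
    rw [mul_comm]
    gcongr
    exact_mod_cast Nat.choose_le_pow s (k - 1)
  -- vertices outside an independent set
  have hβ' : (n : ℝ) * ((1 - p) ^ s.choose (k - 1) +
      s.choose (k - 1) * (p * (1 - p) ^ (s.choose (k - 1) - 1))) ≤ robustError k ε L := by
    have h1 := one_sub_pow_add_le h0.le hp1 hM hy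
    -- With e^t = n/(s+1) ≥ n^(1/k+c), the 1/k pays for the `n` outside vertices and `c` leaves
    -- n^(-kc).
    have h2 : (n : ℝ) * Real.exp (-(k * t)) ≤ Real.exp (-(k * c * L)) := by
      rw [← hexpL, ← Real.exp_add]
      refine Real.exp_le_exp.2 ?_
      have : k * ((1 / k + c) * L) ≤ k * t := by gcongr
      have e : k * ((1 / k + c) * L) = L + k * c * L := by field_simp
      linarith
    calc _ ≤ (n : ℝ) * ((1 + 2 * P) * Real.exp (-(k * (t - Λ)))) := by gcongr
      _ = (1 + 2 * P) * X ^ k * (n * Real.exp (-(k * t))) := by rw [hexpy]; ring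
      _ ≤ (1 + 2 * P) * X ^ k * Real.exp (-(k * c * L)) := by gcongr
      _ = _ := rfl
  -- two steps above the threshold
  have hupper : (randomHypergraph n k p).real {H | s + 2 ≤ H.indepNum} ≤
      firstMomentError k ε L := by
    refine (real_le_indepNum_le h0.le (by linarith) (by omega)).trans ?_
    refine (choose_succ_mul_pow_le hk0 h0.le (by linarith) hE2 hy).trans ?_
    rw [← hexpt, hexpy]
    calc X * (Real.exp t * (Real.exp (-(k * t)) * X ^ k))
        = X ^ (k + 1) * Real.exp (t + -(k * t)) := by rw [Real.exp_add]; ring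
      _ ≤ X ^ (k + 1) * Real.exp (-(1 / k * L)) := by
          gcongr
          have : 2 * t ≤ k * t := mul_le_mul_of_nonneg_right hk2 (by linarith)
          linarith
      _ = _ := rfl
  -- the second moment
  set η : ℝ := 1 / (4 * (k : ℝ) ^ 2) with hη
  have hη0 : 0 < η := by positivity
  have hη1 : η ≤ 1 := by
    rw [hη, div_le_one (by positivity)]
    have : (1 : ℝ) ≤ (k : ℝ) ^ 2 := one_le_pow₀ (by linarith)
    linarith
  have hsk : 4 * (k : ℝ) ≤ η * s := by
    have : ((16 * k ^ 3 : ℕ) : ℝ) ≤ s := by exact_mod_cast hlarge.le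
    push_cast at this
    rw [hη, one_div, inv_mul_eq_div, le_div_iff₀ (by positivity)]
    linarith
  have hs2 : (s : ℝ) ≤ Real.exp ((1 - 1 / k) * L) := by
    rw [← Real.log_le_iff_le_exp hs']
    have : Real.log (s : ℝ) ≤ Real.log ((s : ℝ) + 1) := Real.log_le_log hs' (by linarith)
    linarith
  have hbase : Real.exp 1 ^ 2 * P ^ 2 * (n / s) * Real.exp (-((1 + η / 2) * (t - Λ))) ≤ 1 / 2 := by
    have hs1 : (1 : ℝ) ≤ s := by exact_mod_cast Nat.one_le_iff_ne_zero.2 hs0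
    have h1 : (n : ℝ) / s ≤ 2 * Real.exp t := by
      rw [hexpt, mul_div_assoc', div_le_div_iff₀ hs' (by positivity)]
      have : (n : ℝ) * 1 ≤ n * s := by gcongr
      linarith
    -- One e^t cancels `n / s` up to a constant; the surplus η/2 leaves n^(-η/(2k)) = n^(-1/(8k³)).
    have h2 : Real.exp t * Real.exp (-((1 + η / 2) * (t - Λ))) ≤
        X ^ 2 * Real.exp (-(1 / (8 * (k : ℝ) ^ 3) * L)) := by
      rw [← hexpΛ, ← Real.exp_nat_mul, ← Real.exp_add, ← Real.exp_add]
      refine Real.exp_le_exp.2 ?_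
      have h3 : η / 2 * (1 / k * L) ≤ η / 2 * t := by gcongr
      have h4 : η / 2 * (1 / k * L) = 1 / (8 * (k : ℝ) ^ 3) * L := by
        rw [hη]; field_simp; norm_num
      have h5 : η / 2 * Λ ≤ 1 * Λ := by
        gcongr
        linarith
      push_cast
      linarith
    calc _ ≤ Real.exp 1 ^ 2 * P ^ 2 * (2 * Real.exp t) *
          Real.exp (-((1 + η / 2) * (t - Λ))) := by gcongr
      _ = 2 * Real.exp 1 ^ 2 * P ^ 2 * (Real.exp t * Real.exp (-((1 + η / 2) * (t - Λ)))) := by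
          ring
      _ ≤ 2 * Real.exp 1 ^ 2 * P ^ 2 * (X ^ 2 * Real.exp (-(1 / (8 * (k : ℝ) ^ 3) * L))) := by
          gcongr
      _ ≤ 1 / 2 := by rw [← mul_assoc]; exact hb
  have hκ : 2 * p * (Real.exp (2 * η * L) * (s : ℝ) ^ 2 / n) ^ k ≤
      2 * P * Real.exp (-(1 / (2 * k) * L)) := by
    -- The factor `s ^ (k - 1)` is absorbed by `p` through `hP`; the remaining `s ^ (k + 1)` is
    -- bounded by `hs2`.
    have e1 : (s : ℝ) ^ (2 * k) = (s : ℝ) ^ (k - 1) * (s : ℝ) ^ (k + 1) := by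
      rw [← pow_add]; congr 1; omega
    calc 2 * p * (Real.exp (2 * η * L) * (s : ℝ) ^ 2 / n) ^ k
        = 2 * (p * (s : ℝ) ^ (k - 1)) * ((s : ℝ) ^ (k + 1) *
          (Real.exp (2 * η * L) * Real.exp (-L)) ^ k) := by
          rw [Real.exp_neg, hexpL, div_pow, mul_pow, mul_pow, ← pow_mul, e1, inv_pow]
          field_simp
      _ ≤ 2 * P * (Real.exp ((1 - 1 / k) * L) ^ (k + 1) *
          (Real.exp (2 * η * L) * Real.exp (-L)) ^ k) := by gcongr
      _ = 2 * P * Real.exp (-(1 / (2 * k) * L)) := by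
          congr 1
          rw [← Real.exp_add, ← Real.exp_nat_mul, ← Real.exp_nat_mul, ← Real.exp_add, hη]
          congr 1
          push_cast
          field_simp
          ring
  have hnear := near_sum_le (n := n) hk h0.le (by linarith) hs0 hη0 hη1 hsk (by linarith) hy hP
    hbase
  have hfar := far_sum_le hk h0.le hp1 hs0 (by omega) hup hκ hr
  have hsm := second_moment_bound hk0 h0.le (by linarith) hs0 (by omega) _ hβ hβ' hfar hnear
  have hEn : 2 / expectedNumIndep n k p s ≤ 2 / X := by
    rw [expectedNumIndep_eq h0.le (by linarith)]
    gcongr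
  set μs := (randomHypergraph n k p).real {H | s ≤ H.indepNum} with hμs
  have hRpos : 0 < secondMomentRatio k ε L := by
    unfold secondMomentRatio
    positivity
  have hlower : (1 - robustError k ε L) ^ 2 / secondMomentRatio k ε L ≤ μs := by
    rw [div_le_iff₀ hRpos, mul_comm]
    refine hsm.trans (mul_le_mul_of_nonneg_right ?_ measureReal_nonneg)
    unfold secondMomentRatio
    linarith
  have hcover : {H : UniformHypergraph (Fin n) k | s ≤ H.indepNum} ⊆
      {H | H.indepNum = s ∨ H.indepNum = s + 1} ∪ {H | s + 2 ≤ H.indepNum} := by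
    intro H hH
    simp only [Set.mem_ofPred_eq, Set.mem_union] at hH ⊢
    omega
  have hsplit := (measureReal_mono (μ := randomHypergraph n k p) hcover).trans
    (measureReal_union_le _ _)
  linarith

/-! ### Limits of the error terms and conclusion -/

theorem tendsto_pow_mul_exp_neg_mul (m : ℕ) {b : ℝ} (hb : 0 < b) :
    Tendsto (fun x : ℝ => x ^ m * Real.exp (-(b * x))) atTop (𝓝 0) := by
  have := tendsto_rpow_mul_exp_neg_mul_atTop_nhds_zero m b hb
  simpa only [Real.rpow_natCast, neg_mul] using this

theorem tendsto_robustError {k : ℕ} (hk : 2 ≤ k) {ε : ℝ} (hε : 0 < ε) :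
    Tendsto (robustError k ε) atTop (𝓝 0) := by
  have hk2 : (2 : ℝ) ≤ k := by exact_mod_cast hk
  have hb : 0 < (k : ℝ) * (ε / (2 * (k - 1))) := by
    have : (0 : ℝ) < k - 1 := by linarith
    positivity
  have h1 := (tendsto_pow_mul_exp_neg_mul k hb).const_mul (ε ^ k)
  have h2 := (tendsto_pow_mul_exp_neg_mul (k + 1) hb).const_mul (2 * (k : ℝ) ^ k * ε ^ k)
  have h := h1.add h2
  simp only [mul_zero, add_zero] at h
  refine h.congr fun x => ?_
  rw [robustError, mul_pow]
  ring

theorem tendsto_firstMomentError {k : ℕ} (hk : k ≠ 0) (ε : ℝ) :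
    Tendsto (firstMomentError k ε) atTop (𝓝 0) := by
  have hb : (0 : ℝ) < 1 / k := by
    have : (0 : ℝ) < k := by exact_mod_cast Nat.pos_of_ne_zero hk
    positivity
  have h := (tendsto_pow_mul_exp_neg_mul (k + 1) hb).const_mul (ε ^ (k + 1))
  rw [mul_zero] at h
  refine h.congr fun x => ?_
  rw [firstMomentError, mul_pow]
  ring

theorem tendsto_secondMomentRatio {k : ℕ} (hk : k ≠ 0) {ε : ℝ} (hε : 0 < ε) :
    Tendsto (secondMomentRatio k ε) atTop (𝓝 1) := by
  have hk' : (0 : ℝ) < k := by exact_mod_cast Nat.pos_of_ne_zero hk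
  have h1 : Tendsto (fun x : ℝ => 2 * ((k : ℝ) ^ k * x) * Real.exp (-(1 / (2 * k) * x)))
      atTop (𝓝 0) := by
    have h := (tendsto_pow_mul_exp_neg_mul 1
      (show (0 : ℝ) < 1 / (2 * k) by positivity)).const_mul (2 * (k : ℝ) ^ k)
    rw [mul_zero] at h
    refine h.congr fun x => ?_
    ring
  have h2 := (tendsto_pow_mul_exp_neg_mul 0
    (show (0 : ℝ) < 1 / (4 * (k : ℝ) ^ 2) by positivity)).const_mul (2 * Real.exp 1)
  have h3 : Tendsto (fun x : ℝ => 2 / (ε * x)) atTop (𝓝 0) :=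
    (tendsto_id.const_mul_atTop hε).const_div_atTop 2
  have h := (((Real.continuous_exp.tendsto 0).comp h1).add h2).add h3
  simp only [Real.exp_zero, mul_zero, add_zero] at h
  refine h.congr fun x => ?_
  simp only [secondMomentRatio, Function.comp_apply, pow_zero]
  ring

theorem mainTheorem6 (k : ℕ) (hk : 2 ≤ k) (ε : ℝ) (hε : 0 < ε) (p : ℕ → ℝ)
    (hp : ∀ᶠ n : ℕ in atTop, (n : ℝ) ^ (-(((k : ℝ) - 1) ^ 2 / (k : ℝ)) + ε) < p n)
    (hp0 : Tendsto p atTop (𝓝 0)) :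
    (∀ᶠ n : ℕ in atTop,
      IsGreatest (thresholdSizes n k (p n) ε) (expectationThreshold n k (p n) ε)) ∧
    Tendsto (fun n : ℕ => (randomHypergraph n k (p n)).real
      {H | H.indepNum = expectationThreshold n k (p n) ε ∨
        H.indepNum = expectationThreshold n k (p n) ε + 1}) atTop (𝓝 1) := by
  have hk0 : k ≠ 0 := by omega
  have hkpos : (0 : ℝ) < k := by exact_mod_cast Nat.pos_of_ne_zero hk0
  have hlog : Tendsto (fun n : ℕ => Real.log n) atTop atTop :=
    Real.tendsto_log_atTop.comp tendsto_natCast_atTop_atTop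
  have hpos : ∀ᶠ n : ℕ in atTop, 0 < p n :=
    hp.mono fun n hn => (Real.rpow_nonneg (Nat.cast_nonneg n) _).trans_lt hn
  have hhalf : ∀ᶠ n : ℕ in atTop, p n ≤ 1 / 2 := hp0.eventually_le_const (by norm_num)
  have hL : ∀ᶠ n : ℕ in atTop, 1 ≤ Real.log n := hlog.eventually_ge_atTop 1
  have hx1 : ∀ᶠ n : ℕ in atTop, 1 ≤ ε * Real.log n :=
    (hlog.const_mul_atTop hε).eventually_ge_atTop 1
  have loglin : ∀ {a b c : ℝ}, 0 < b → 0 < c →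
      ∀ᶠ x : ℝ in atTop, a + Real.log (b * x) ≤ c * x := by
    intro a b c hb hc
    have h1 : ∀ᶠ x : ℝ in atTop, Real.log x ≤ c / 2 * x := by
      filter_upwards [Real.isLittleO_log_id_atTop.bound (half_pos hc), eventually_ge_atTop 0]
        with x hx hx0
      rw [id, Real.norm_of_nonneg hx0] at hx
      exact (Real.le_norm_self _).trans hx
    have h2 : ∀ᶠ x : ℝ in atTop, a + Real.log b ≤ c / 2 * x :=
      (tendsto_id.const_mul_atTop (half_pos hc)).eventually_ge_atTop _
    filter_upwards [h1, h2, eventually_gt_atTop 0] with x h1 h2 hx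
    rw [Real.log_mul hb.ne' hx.ne']
    linarith
  have hxn : ∀ᶠ n : ℕ in atTop, ε * Real.log n < n := by
    -- At x = log n the function x e^(-x) equals (log n)/n.
    have h := (tendsto_pow_mul_exp_neg_mul 1 one_pos).const_mul ε
    rw [mul_zero] at h
    filter_upwards [hlog.eventually (h.eventually_lt_const one_pos), eventually_gt_atTop 0]
      with n hn hn0
    have hn0' : (0 : ℝ) < n := by exact_mod_cast hn0
    rw [one_mul, pow_one, Real.exp_neg, Real.exp_log hn0', ← mul_assoc, ← div_eq_mul_inv,
      div_lt_one hn0'] at hn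
    exact hn
  refine ⟨?_, ?_⟩
  · filter_upwards [hpos, hhalf, hx1, hxn] with n h0 h1 h2 h3
    exact (isGreatest_expectationThreshold hk h0.le (by linarith) (by linarith) h3).1
  have e1 : ∀ᶠ n : ℕ in atTop, ((k : ℝ) - 1) * Real.log 2 +
      Real.log ((k : ℝ) ^ k * Real.log n) ≤ ε / 2 * Real.log n :=
    hlog.eventually (loglin (by positivity) (by positivity))
  have e2 : ∀ᶠ n : ℕ in atTop, 1 + Real.log (ε * Real.log n) ≤ 1 / k * Real.log n :=
    hlog.eventually (loglin hε (by positivity))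
  have e3 : ∀ᶠ n : ℕ in atTop, 2 * p n * ((16 * k ^ 3 : ℕ) : ℝ) ^ (k - 1) < 1 := by
    have h := (hp0.const_mul 2).mul_const (((16 * k ^ 3 : ℕ) : ℝ) ^ (k - 1))
    rw [mul_zero, zero_mul] at h
    exact h.eventually_lt_const one_pos
  have e4 : ∀ᶠ n : ℕ in atTop, 2 * Real.exp 1 ^ 2 * ((k : ℝ) ^ k * Real.log n) ^ 2 *
      (ε * Real.log n) ^ 2 * Real.exp (-(1 / (8 * (k : ℝ) ^ 3) * Real.log n)) ≤ 1 / 2 := by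
    have h := (tendsto_pow_mul_exp_neg_mul 4
      (show (0 : ℝ) < 1 / (8 * (k : ℝ) ^ 3) by positivity)).const_mul
        (2 * Real.exp 1 ^ 2 * ((k : ℝ) ^ k) ^ 2 * ε ^ 2)
    rw [mul_zero] at h
    filter_upwards [hlog.eventually (h.eventually_le_const (show (0 : ℝ) < 1 / 2 by norm_num))]
      with n hn
    refine le_trans (le_of_eq ?_) hn
    ring
  have e5 : ∀ᶠ n : ℕ in atTop,
      Real.exp 1 * Real.exp (-(1 / (4 * (k : ℝ) ^ 2) * Real.log n)) ≤ 1 / 2 := by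
    have h := (tendsto_pow_mul_exp_neg_mul 0
      (show (0 : ℝ) < 1 / (4 * (k : ℝ) ^ 2) by positivity)).const_mul (Real.exp 1)
    simp only [pow_zero, one_mul, mul_zero] at h
    exact hlog.eventually (h.eventually_le_const (by norm_num))
  have hβ := (tendsto_robustError hk hε).comp hlog
  have e6 : ∀ᶠ n : ℕ in atTop, robustError k ε (Real.log n) ≤ 1 :=
    hβ.eventually_le_const one_pos
  have hlim : Tendsto (fun n : ℕ => (1 - robustError k ε (Real.log n)) ^ 2 /
      secondMomentRatio k ε (Real.log n) - firstMomentError k ε (Real.log n)) atTop (𝓝 1) := by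
    have h := ((((hβ.const_sub 1).pow 2).div
      ((tendsto_secondMomentRatio hk0 hε).comp hlog) one_ne_zero).sub
      ((tendsto_firstMomentError hk0 ε).comp hlog))
    simpa using h
  refine tendsto_of_tendsto_of_tendsto_of_le_of_le' hlim tendsto_const_nhds ?_ ?_
  · filter_upwards [hpos, hhalf, hp, hL, hx1, hxn, e1, e2, e3, e4, e5, e6]
      with n h0 h1 h2 h3 h4 h5 h6 h7 h8 h9 h10 h11
    exact le_real_indepNum_eq_threshold hk hε h0 h1 h2 h3 h4 h5 h6 (by linarith) h8 h9 h10 h11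
  · filter_upwards [hpos, hhalf] with n h0 h1
    have := randomHypergraph_isProbabilityMeasure n k h0.le (by linarith)
    exact measureReal_le_one
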